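/- Let $d,M\ge 1$ and $T\ge 0$ be integers. A learner interacts with an environment with action space $\mathcal A$ and a measurable feature map $\phi:\mathcal A\to\{x\in\mathbb R^d:\|x\|_2\le 1\}$. At each time $t=1,2,\dots$ a (random) decision set $\mathcal A_t\subseteq\mathcal A$ is presented, the learner chooses an action $A_t\in\mathcal A_t$ by any rule, which may depend on all of the past and on additional randomness (in particular by index sampling), receives a feedback $Y_t$, and samples a perturbation $\mathbf z_t\sim P_z$ in $\mathbb R^M$, independent of $(\mathcal A_1,A_1,Y_1,\dots,\mathcal A_{t-1},A_{t-1},Y_{t-1},\mathcal A_t)$, of $A_t$ and of all earlier perturbations. Let $\mathbf Z_0\in\mathbb R^{d\times M}$ have i.i.d. rows with law $P_z$; it counts among the earlier perturbations. Let $\boldsymbol\Sigma_0\in\mathbb R^{d\times d}$ be symmetric positive definite (for example $\boldsymbol\Sigma_0=\lambda^{-1}I$ with $\lambda>0$), $\mathbf A_0=\boldsymbol\Sigma_0^{1/2}\mathbf Z_0$, and for $t\ge1$ $$\boldsymbol\Sigma_t^{-1}=\boldsymbol\Sigma_{t-1}^{-1}+\phi(A_t)\phi(A_t)^\top,\qquad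 \mathbf A_t=\boldsymbol\Sigma_t\big(\boldsymbol\Sigma_{t-1}^{-1}\mathbf A_{t-1}+\phi(A_t)\mathbf z_t^\top\big).$$ Put $s_{\min}^2=\inf_{\|a\|_2=1}a^\top\boldsymbol\Sigma_0^{-1}a$ and $s_{\max}^2=\sup_{\|a\|_2=1}a^\top\boldsymbol\Sigma_0^{-1}a$ ($s_{\min},s_{\max}>0$), let $0<\delta<1$, and $$m(d,T,s_{\min},s_{\max},\delta)=320\left(d\log\frac{1+(48/s_{\min})\sqrt{s_{\max}^2+T}}{\delta}+\log\Big(1+\frac{T}{s_{\min}^2}\Big)\right).$$ (a) Suppose that $P_z$ is unit-norm, i.e. $\|z\|_2=1$ for $P_z$-almost every $z$, and $\sqrt{1/M}$-sub-Gaussian, i.e. $\mathbb E_{z\sim P_z}\exp(\ell\langle v,z\rangle)\le\exp(\ell^2/(2M))$ for all unit vectors $v\in\mathbb R^M$ and all $\ell\in\mathbb R$, and that $M\ge m(d,T,s_{\min},s_{\max},\delta)$. Then with probability at least $1-\delta$, simultaneously for all $0\le t\le T$ and all $x\in\mathbb R^d$, $$\tfrac12\,x^\top\boldsymbol\Sigma_t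 x\;\le\;x^\top\mathbf A_t\mathbf A_t^\top x\;\le\;\tfrac32\,x^\top\boldsymbol\Sigma_t x .$$ Moreover, for every $t\ge0$, $(\boldsymbol\Sigma_{t+1}^{-1},\boldsymbol\Sigma_{t+1},\mathbf A_{t+1})$ is computed from $(\boldsymbol\Sigma_t^{-1},\boldsymbol\Sigma_t,\mathbf A_t)$, $\phi(A_{t+1})$ and $\mathbf z_{t+1}$ by the direct update procedure that uses the two displayed recursions, entrywise and with schoolbook matrix products, and $\boldsymbol\Sigma_{t+1}=\boldsymbol\Sigma_t-\frac{\boldsymbol\Sigma_t xx^\top\boldsymbol\Sigma_t}{1+x^\top\boldsymbol\Sigma_t x}$, $x=\phi(A_{t+1})$. (b) The threshold is of order $d\log T$ and the cost of an update is $\tilde O(\log T)$ in $T$: for all $0<s_{\min}\le s_{\max}$ and $0<\delta<1$ there are constants $c,C,K>0$, depending only on $s_{\min},s_{\max},\delta$, such that for all integers $d\ge1$, $T\ge2$ $$c\,d\log T\le m(d,T,s_{\min},s_{\max},\delta)\le C\,d\log T,$$ and with $M=\lceil m(d,T,s_{\min},s_{\max},\delta)\rceil$ one call of the update procedure uses at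 most $K\,d^3\log T$ real additions, subtractions, multiplications and divisions. -/

import Mathlib

open MeasureTheory ProbabilityTheory
open scoped Matrix NNReal MatrixOrder Matrix.Norms.L2Operator

noncomputable section

/-! ### Sub-Gaussian and unit-norm distributions -/

/-- A distribution on `ℝ^M` is `σ`-sub-Gaussian if every one-dimensional projection along a unit
vector `v` satisfies `E exp (l ⟨v, z⟩) ≤ exp (l² σ² / 2)` for all real `l`. -/
def IsSubGaussianLaw {M : ℕ} (P : Measure (EuclideanSpace ℝ (Fin M))) (σ : ℝ≥0) : Prop :=
  ∀ v : EuclideanSpace ℝ (Fin M), ‖v‖ = 1 →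
    HasSubgaussianMGF (fun z : EuclideanSpace ℝ (Fin M) => inner ℝ v z) (σ ^ 2) P

/-- A distribution on `ℝ^M` is (almost surely) unit-norm. -/
def IsUnitNormLaw {M : ℕ} (P : Measure (EuclideanSpace ℝ (Fin M))) : Prop :=
  ∀ᵐ z ∂P, ‖z‖ = 1

/-! ### Sequential interaction with fresh perturbations -/

/-- The random objects of an interaction with a bandit environment with feature map `φ`: at time
`t = 1, 2, …` a decision set is presented, an action is chosen, a feedback is received, and a
perturbation vector `pert t` in `ℝ^M` is sampled. The vectors `initPert i` are the `d` rows of the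
initial perturbation matrix. Only the indices `t ≥ 1` of the sequences are used. -/
structure BanditRun (Ω 𝒜 : Type*) (d M : ℕ) where
  φ : 𝒜 → EuclideanSpace ℝ (Fin d)
  decisionSet : ℕ → Ω → Set 𝒜
  action : ℕ → Ω → 𝒜
  feedback : ℕ → Ω → ℝ
  initPert : Fin d → Ω → EuclideanSpace ℝ (Fin M)
  pert : ℕ → Ω → EuclideanSpace ℝ (Fin M)

namespace BanditRun

variable {Ω 𝒜 : Type*} {d M : ℕ}

/-- The σ-algebra generated by the history
`(𝒜_1, A_1, Y_1, …, 𝒜_{t-1}, A_{t-1}, Y_{t-1}, 𝒜_t)`; the sets of actions carry the σ-algebra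
generated by the events `{a ∈ 𝒜_s}`. -/
@[reducible] def history [MeasurableSpace 𝒜] (R : BanditRun Ω 𝒜 d M) (t : ℕ) : MeasurableSpace Ω :=
  (⨆ s ∈ Finset.Icc 1 t, MeasurableSpace.comap (R.decisionSet s) inferInstance) ⊔
    ⨆ s ∈ Finset.Ico 1 t,
      (MeasurableSpace.comap (R.action s) inferInstance ⊔
        MeasurableSpace.comap (R.feedback s) inferInstance)

/-- The σ-algebra generated by the initial perturbation matrix and `z_1, …, z_{t-1}`. -/
@[reducible] def pertHistory (R : BanditRun Ω 𝒜 d M) (t : ℕ) : MeasurableSpace Ω :=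
  (⨆ i, MeasurableSpace.comap (R.initPert i) inferInstance) ⊔
    ⨆ s ∈ Finset.Ico 1 t, MeasurableSpace.comap (R.pert s) inferInstance

/-- The modelling conditions: the features lie in the closed unit ball, everything is measurable,
actions are taken from the decision sets, the rows of the initial perturbation matrix are i.i.d.
with law `Pz`, and at each time `t ≥ 1` the perturbation `z_t` is freshly sampled from `Pz`, i.e.
independently of the history, of the action `A_t` and of all earlier perturbations. No restriction
is put on how the action `A_t` is selected: it may depend on all of the past and on any further
randomness such as a sampled index. -/
structure IsValid [MeasurableSpace Ω] [MeasurableSpace 𝒜] (R : BanditRun Ω 𝒜 d M)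
    (μ : Measure Ω) (Pz : Measure (EuclideanSpace ℝ (Fin M))) : Prop where
  norm_φ_le : ∀ a, ‖R.φ a‖ ≤ 1
  measurable_φ : Measurable R.φ
  measurable_decisionSet : ∀ t, 1 ≤ t → Measurable (R.decisionSet t)
  measurable_action : ∀ t, 1 ≤ t → Measurable (R.action t)
  measurable_feedback : ∀ t, 1 ≤ t → Measurable (R.feedback t)
  measurable_initPert : ∀ i, Measurable (R.initPert i)
  measurable_pert : ∀ t, 1 ≤ t → Measurable (R.pert t)
  action_mem : ∀ t, 1 ≤ t → ∀ᵐ ω ∂μ, R.action t ω ∈ R.decisionSet t ω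
  law_initPert : ∀ i, μ.map (R.initPert i) = Pz
  indep_initPert : iIndepFun R.initPert μ
  law_pert : ∀ t, 1 ≤ t → μ.map (R.pert t) = Pz
  indep_pert : ∀ t, 1 ≤ t →
    Indep (MeasurableSpace.comap (R.pert t) inferInstance)
      (R.history t ⊔ MeasurableSpace.comap (R.action t) inferInstance ⊔ R.pertHistory t) μ

/-- The feature vector `φ(A_t)`. -/
def feature (R : BanditRun Ω 𝒜 d M) (t : ℕ) (ω : Ω) : Fin d → ℝ :=
  (R.φ (R.action t ω)).ofLp

/-- The perturbation `z_t` as a coordinate vector. -/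
def pertVec (R : BanditRun Ω 𝒜 d M) (t : ℕ) (ω : Ω) : Fin M → ℝ :=
  (R.pert t ω).ofLp

/-- The initial perturbation matrix `Z_0` with rows `z_{0,1}, …, z_{0,d}`. -/
def initMatrix (R : BanditRun Ω 𝒜 d M) (ω : Ω) : Matrix (Fin d) (Fin M) ℝ :=
  Matrix.of fun i => (R.initPert i ω).ofLp

/-- The precision matrix `Σ_t⁻¹`, with `Σ_t⁻¹ = Σ_{t-1}⁻¹ + φ(A_t) φ(A_t)ᵀ`. -/
def precision (R : BanditRun Ω 𝒜 d M) (S₀ : Matrix (Fin d) (Fin d) ℝ) :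
    ℕ → Ω → Matrix (Fin d) (Fin d) ℝ
  | 0, _ => S₀⁻¹
  | t + 1, ω => R.precision S₀ t ω +
      Matrix.vecMulVec (R.feature (t + 1) ω) (R.feature (t + 1) ω)

/-- The posterior covariance matrix `Σ_t`. -/
def covariance (R : BanditRun Ω 𝒜 d M) (S₀ : Matrix (Fin d) (Fin d) ℝ) (t : ℕ) (ω : Ω) :
    Matrix (Fin d) (Fin d) ℝ :=
  (R.precision S₀ t ω)⁻¹

/-- The incrementally updated factor: `A_0 = Σ_0^{1/2} Z_0` and
`A_t = Σ_t (Σ_{t-1}⁻¹ A_{t-1} + φ(A_t) z_tᵀ)`. -/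
def factor (R : BanditRun Ω 𝒜 d M) (S₀ : Matrix (Fin d) (Fin d) ℝ) :
    ℕ → Ω → Matrix (Fin d) (Fin M) ℝ
  | 0, ω => CFC.sqrt S₀ * R.initMatrix ω
  | t + 1, ω => R.covariance S₀ (t + 1) ω *
      (R.precision S₀ t ω * R.factor S₀ t ω +
        Matrix.vecMulVec (R.feature (t + 1) ω) (R.pertVec (t + 1) ω))

/-- The good event at time `t`: the form of `A_t A_tᵀ` lies between `1/2` and `3/2` times that of
`Σ_t`, in all directions. -/
def goodEvent (R : BanditRun Ω 𝒜 d M) (S₀ : Matrix (Fin d) (Fin d) ℝ) (t : ℕ) : Set Ω :=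
  {ω | ∀ x : Fin d → ℝ,
    1 / 2 * (x ⬝ᵥ R.covariance S₀ t ω *ᵥ x) ≤
        x ⬝ᵥ (R.factor S₀ t ω * (R.factor S₀ t ω)ᵀ) *ᵥ x ∧
      x ⬝ᵥ (R.factor S₀ t ω * (R.factor S₀ t ω)ᵀ) *ᵥ x ≤
        3 / 2 * (x ⬝ᵥ R.covariance S₀ t ω *ᵥ x)}

end BanditRun

/-! ### The threshold for the index dimension -/

/-- `s_min`, where `s_min² = inf_{‖a‖ = 1} aᵀ Σ_0⁻¹ a`. -/
def sMin {d : ℕ} (S₀ : Matrix (Fin d) (Fin d) ℝ) : ℝ :=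
  √(⨅ a : Metric.sphere (0 : EuclideanSpace ℝ (Fin d)) 1,
    (a : EuclideanSpace ℝ (Fin d)).ofLp ⬝ᵥ S₀⁻¹ *ᵥ (a : EuclideanSpace ℝ (Fin d)).ofLp)

/-- `s_max`, where `s_max² = sup_{‖a‖ = 1} aᵀ Σ_0⁻¹ a`. -/
def sMax {d : ℕ} (S₀ : Matrix (Fin d) (Fin d) ℝ) : ℝ :=
  √(⨆ a : Metric.sphere (0 : EuclideanSpace ℝ (Fin d)) 1,
    (a : EuclideanSpace ℝ (Fin d)).ofLp ⬝ᵥ S₀⁻¹ *ᵥ (a : EuclideanSpace ℝ (Fin d)).ofLp)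

/-- `320 (d log ((1 + (48 / s) √(s'² + T)) / δ) + log (1 + T / s²))` with `s = s_min`,
`s' = s_max`. -/
def indexDimBound (d T : ℕ) (s s' δ : ℝ) : ℝ :=
  320 * (d * Real.log ((1 + 48 / s * √(s' ^ 2 + T)) / δ) + Real.log (1 + T / s ^ 2))

/-! ### Counting the arithmetic operations of one incremental update -/

/-- The result of a computation together with the number of real arithmetic operations
(additions, subtractions, multiplications, divisions) that it has performed. -/
structure Counted (α : Type) where
  val : α
  ops : ℕ

namespace Counted

instance : Monad Counted where
  pure a := ⟨a, 0⟩
  bind c f := ⟨(f c.val).val, c.ops + (f c.val).ops⟩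

/-- One addition. -/
def add (a b : ℝ) : Counted ℝ := ⟨a + b, 1⟩

/-- One subtraction. -/
def sub (a b : ℝ) : Counted ℝ := ⟨a - b, 1⟩

/-- One multiplication. -/
def mul (a b : ℝ) : Counted ℝ := ⟨a * b, 1⟩

/-- One division. -/
def div (a b : ℝ) : Counted ℝ := ⟨a / b, 1⟩

/-- A loop that computes `n` terms and adds each of them to an accumulator. -/
def sum {n : ℕ} (f : Fin n → Counted ℝ) : Counted ℝ :=
  ⟨∑ i, (f i).val, ∑ i, ((f i).ops + 1)⟩

/-- A loop that computes and stores the entries of a vector. -/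
def vector {n : ℕ} (f : Fin n → Counted ℝ) : Counted (Fin n → ℝ) :=
  ⟨fun i => (f i).val, ∑ i, (f i).ops⟩

/-- A double loop that computes and stores the entries of a matrix. -/
def matrix {m n : ℕ} (f : Fin m → Fin n → Counted ℝ) : Counted (Matrix (Fin m) (Fin n) ℝ) :=
  ⟨Matrix.of fun i j => (f i j).val, ∑ i, ∑ j, (f i j).ops⟩

/-- Inner product of two vectors. -/
def dot {n : ℕ} (x y : Fin n → ℝ) : Counted ℝ :=
  sum fun i => mul (x i) (y i)

/-- Schoolbook matrix multiplication. -/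
def matMul {l m n : ℕ} (A : Matrix (Fin l) (Fin m) ℝ) (B : Matrix (Fin m) (Fin n) ℝ) :
    Counted (Matrix (Fin l) (Fin n) ℝ) :=
  matrix fun i j => dot (fun k => A i k) (fun k => B k j)

end Counted

/-- What the incremental procedure stores: `Σ_t⁻¹`, `Σ_t` and `A_t`. -/
structure UpdateState (d M : ℕ) where
  prec : Matrix (Fin d) (Fin d) ℝ
  cov : Matrix (Fin d) (Fin d) ℝ
  fac : Matrix (Fin d) (Fin M) ℝ

/-- One incremental update with feature vector `x` and perturbation `z`, carried out with scalar
operations: the covariance by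
`Σ_t = Σ_{t-1} - Σ_{t-1} x xᵀ Σ_{t-1} / (1 + xᵀ Σ_{t-1} x)`, the precision by
`Σ_t⁻¹ = Σ_{t-1}⁻¹ + x xᵀ`, and the factor by `A_t = Σ_t (Σ_{t-1}⁻¹ A_{t-1} + x zᵀ)`. -/
def incrementalUpdate {d M : ℕ} (st : UpdateState d M) (x : Fin d → ℝ) (z : Fin M → ℝ) :
    Counted (UpdateState d M) := do
  let u ← Counted.vector fun i => Counted.dot (fun k => st.cov i k) x
  let w ← Counted.vector fun j => Counted.dot x (fun k => st.cov k j)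
  let q ← Counted.dot x u
  let c ← Counted.add 1 q
  let cov' ← Counted.matrix fun i j => do
    let p ← Counted.mul (u i) (w j)
    let r ← Counted.div p c
    Counted.sub (st.cov i j) r
  let prec' ← Counted.matrix fun i j => do
    let p ← Counted.mul (x i) (x j)
    Counted.add (st.prec i j) p
  let b ← Counted.matMul st.prec st.fac
  let b' ← Counted.matrix fun i j => do
    let p ← Counted.mul (x i) (z j)
    Counted.add (b i j) p
  let fac' ← Counted.matMul cov' b'
  return ⟨prec', cov', fac'⟩

/-- The matrices `Σ_t⁻¹`, `Σ_t`, `A_t` of a run. -/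
def BanditRun.updateState {Ω 𝒜 : Type*} {d M : ℕ} (R : BanditRun Ω 𝒜 d M)
    (S₀ : Matrix (Fin d) (Fin d) ℝ) (t : ℕ) (ω : Ω) : UpdateState d M :=
  ⟨R.precision S₀ t ω, R.covariance S₀ t ω, R.factor S₀ t ω⟩

end

/-! ### Exponential moments of squares -/

/-! Write P_t for Σ_t⁻¹. Multiplying the factor recursion by P_t removes the adaptive inverse: P_t
A_t = Σ₀^{-1/2} Z₀ + ∑ φ(A_s) z_sᵀ. For a fixed direction a, the vector aᵀ P_t A_t is therefore a
sum Y = ∑ c_k z_k with predictable coefficients, and V = ∑ c_k² is exactly aᵀ P_t a. Substituting a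
= Σ_t x, the claim becomes |‖Y‖² - V| ≤ V / 2 for every a.

Since ‖z‖ = 1, one step changes ‖Y‖² - V only by 2c⟨Y, z⟩, whose variance proxy 4c²‖Y‖²/M is of
order c²V/M as long as the estimate has not yet failed. With W = w + V, the potential exp(θ((‖Y‖² -
V)/W)²)/√W then does not increase in mean (`lintegral_potential_step_le`), and comparing its initial
value with its value at the first failure bounds the failure probability uniformly in time
(`measure_compl_adaptiveGood_le`). The price of adaptivity is only a factor √((w + B)/w), where B
bounds V, hence the log(1 + T/s_min²) in the threshold.

A union bound over a deterministic net of the sphere gives all net directions at once, and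
`abs_form_le_of_net` extends the estimate to every direction. One net serves all t ≤ T because every
P_t lies between s_min² and s_max² + T.

For the cost, the two products of a d × d by a d × M matrix dominate, and M is of order d log T. -/

theorem lintegral_exp_linear_sub_sq (a : ℝ) {q : ℝ} (hq : 0 < q) :
    ∫⁻ g : ℝ, ENNReal.ofReal (Real.exp (a * g - q * g ^ 2 / 2)) =
      ENNReal.ofReal (√(2 * Real.pi / q) * Real.exp (a ^ 2 / (2 * q))) := by
  have hv : (Real.toNNReal q⁻¹) ≠ 0 := by simpa using hq
  have hcoe : ((Real.toNNReal q⁻¹ : ℝ≥0) : ℝ) = q⁻¹ := Real.coe_toNNReal _ (by positivity)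
  have hpos : 0 < √(2 * Real.pi / q) := by positivity
  have h := lintegral_gaussianPDFReal_eq_one (a / q) hv
  have key : ∀ g : ℝ, Real.exp (a * g - q * g ^ 2 / 2) =
      (√(2 * Real.pi / q) * Real.exp (a ^ 2 / (2 * q))) *
        gaussianPDFReal (a / q) (Real.toNNReal q⁻¹) g := by
    intro g
    rw [gaussianPDFReal, hcoe, ← div_eq_mul_inv]
    rw [show √(2 * Real.pi / q) * Real.exp (a ^ 2 / (2 * q)) *
        ((√(2 * Real.pi / q))⁻¹ * Real.exp (-(g - a / q) ^ 2 / (2 * q⁻¹))) =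
        (√(2 * Real.pi / q) * (√(2 * Real.pi / q))⁻¹) *
          (Real.exp (a ^ 2 / (2 * q)) * Real.exp (-(g - a / q) ^ 2 / (2 * q⁻¹))) by ring,
      mul_inv_cancel₀ hpos.ne', one_mul, ← Real.exp_add]
    congr 1
    field_simp
    ring
  simp_rw [key]
  have hnn : 0 ≤ √(2 * Real.pi / q) * Real.exp (a ^ 2 / (2 * q)) := by positivity
  simp_rw [ENNReal.ofReal_mul hnn]
  rw [lintegral_const_mul _ (by fun_prop), h, mul_one]

/-- Gaussian linearization: exp(κx²) is the mean of exp(√(2κ) x g) over a standard normal g.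
Exchanging the integrals, the sub-Gaussian bound on X costs 2κv of the Gaussian's quadratic
exponent, and at least q of it remains. -/
theorem lintegral_exp_sq_le {α : Type*} [MeasurableSpace α] (P : Measure α) [SFinite P]
    {X : α → ℝ} (hX : Measurable X) {v : ℝ}
    (h : ∀ l : ℝ, ∫⁻ ω, ENNReal.ofReal (Real.exp (l * X ω)) ∂P ≤
      ENNReal.ofReal (Real.exp (l ^ 2 * v / 2)))
    {κ q : ℝ} (hκ : 0 ≤ κ) (hq : 0 < q) (hv : 2 * κ * v ≤ 1 - q) (D : ℝ) :
    ∫⁻ ω, ENNReal.ofReal (Real.exp (κ * (D + X ω) ^ 2)) ∂P ≤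
      ENNReal.ofReal (Real.exp (κ * D ^ 2 / q) / √q) := by
  set s := √(2 * κ) with hs
  have hs2 : s ^ 2 = 2 * κ := Real.sq_sqrt (by positivity)
  have hpi : 0 < √(2 * Real.pi) := by positivity
  have h1 : ∀ x : ℝ, ENNReal.ofReal (√(2 * Real.pi)) * ENNReal.ofReal (Real.exp (κ * x ^ 2)) =
      ∫⁻ g : ℝ, ENNReal.ofReal (Real.exp ((s * x) * g - 1 * g ^ 2 / 2)) := by
    intro x
    rw [lintegral_exp_linear_sub_sq _ one_pos, ← ENNReal.ofReal_mul hpi.le, mul_pow, hs2]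
    congr 3
    · simp
    · ring
  have h2 : ENNReal.ofReal (√(2 * Real.pi)) *
      ∫⁻ ω, ENNReal.ofReal (Real.exp (κ * (D + X ω) ^ 2)) ∂P ≤
      ENNReal.ofReal (√(2 * Real.pi)) * ENNReal.ofReal (Real.exp (κ * D ^ 2 / q) / √q) := by
    rw [← lintegral_const_mul _ (by fun_prop)]
    simp_rw [h1]
    rw [lintegral_lintegral_swap (by fun_prop)]
    calc _ ≤ ∫⁻ g : ℝ, ENNReal.ofReal (Real.exp ((s * D) * g - q * g ^ 2 / 2)) := by
          refine lintegral_mono fun g => ?_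
          have e : ∀ ω, ENNReal.ofReal (Real.exp (s * (D + X ω) * g - 1 * g ^ 2 / 2)) =
              ENNReal.ofReal (Real.exp (s * D * g - g ^ 2 / 2)) *
                ENNReal.ofReal (Real.exp ((s * g) * X ω)) := by
            intro ω
            rw [← ENNReal.ofReal_mul (Real.exp_pos _).le, ← Real.exp_add]
            congr 2
            ring
          simp_rw [e]
          rw [lintegral_const_mul _ (by fun_prop)]
          refine (mul_le_mul_right (h (s * g)) _).trans ?_
          rw [← ENNReal.ofReal_mul (Real.exp_pos _).le, ← Real.exp_add]
          refine ENNReal.ofReal_le_ofReal (Real.exp_le_exp.2 ?_)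
          rw [mul_pow, hs2]
          nlinarith [mul_le_mul_of_nonneg_right hv (sq_nonneg g)]
      _ = _ := by
          rw [lintegral_exp_linear_sub_sq _ hq, ← ENNReal.ofReal_mul hpi.le, mul_pow, hs2,
            Real.sqrt_div (by positivity)]
          congr 1
          rw [show 2 * κ * D ^ 2 / (2 * q) = κ * D ^ 2 / q by field_simp]
          ring
  exact (ENNReal.mul_le_mul_iff_right (by simpa using hpi) ENNReal.ofReal_ne_top).1 h2

theorem IsSubGaussianLaw.lintegral_exp_le {M : ℕ} {P : Measure (EuclideanSpace ℝ (Fin M))}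
    [IsProbabilityMeasure P] {σ : ℝ≥0} (h : IsSubGaussianLaw P σ)
    (y : EuclideanSpace ℝ (Fin M)) (l : ℝ) :
    ∫⁻ z, ENNReal.ofReal (Real.exp (l * inner ℝ y z)) ∂P ≤
      ENNReal.ofReal (Real.exp (l ^ 2 * (σ ^ 2 * ‖y‖ ^ 2) / 2)) := by
  by_cases hy : y = 0
  · simp [hy]
  have hn : ‖y‖ ≠ 0 := norm_ne_zero_iff.2 hy
  have h1 := h ((‖y‖)⁻¹ • y) (by rw [norm_smul, norm_inv, norm_norm, inv_mul_cancel₀ hn])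
  have e : ∀ z, Real.exp (l * inner ℝ y z) =
      Real.exp ((l * ‖y‖) * inner ℝ ((‖y‖)⁻¹ • y) z) := by
    intro z
    rw [real_inner_smul_left]
    congr 1
    field_simp
  simp_rw [e]
  rw [← ofReal_integral_eq_lintegral_ofReal (h1.integrable_exp_mul _)
    (Filter.Eventually.of_forall fun _ => (Real.exp_pos _).le)]
  refine ENNReal.ofReal_le_ofReal ((h1.mgf_le (l * ‖y‖)).trans (Real.exp_le_exp.2 (le_of_eq ?_)))
  push_cast
  ring

/-- One step of the potential `exp (θ U²) / √W`, where `U = (‖y‖² - V) / W`. -/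
theorem lintegral_potential_step_le {M : ℕ} {P : Measure (EuclideanSpace ℝ (Fin M))}
    [IsProbabilityMeasure P] {σ : ℝ≥0} (h : IsSubGaussianLaw P σ) (h1 : IsUnitNormLaw P)
    {ε θ : ℝ} (hθ : 0 ≤ θ) (hθσ : 8 * θ * (1 + ε) * σ ^ 2 ≤ 1)
    (y : EuclideanSpace ℝ (Fin M)) (c V : ℝ) {W : ℝ} (hW : 0 < W) (hy : ‖y‖ ^ 2 ≤ (1 + ε) * W) :
    ∫⁻ z, ENNReal.ofReal (Real.exp (θ * ((‖y + c • z‖ ^ 2 - (V + c ^ 2)) / (W + c ^ 2)) ^ 2) /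
        √(W + c ^ 2)) ∂P ≤
      ENNReal.ofReal (Real.exp (θ * ((‖y‖ ^ 2 - V) / W) ^ 2) / √W) := by
  set W' := W + c ^ 2 with hW'
  have hWW : W ≤ W' := by rw [hW']; nlinarith [sq_nonneg c]
  have hW'0 : 0 < W' := hW.trans_le hWW
  set ρ := W / W' with hρ
  have hρ0 : 0 < ρ := by positivity
  have hρ1 : ρ ≤ 1 := (div_le_one hW'0).2 hWW
  set D := ‖y‖ ^ 2 - V with hD
  -- Unit norm enters here: the c² in ‖y + c z‖² cancels the increment of V, leaving D + 2c⟨y, z⟩.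
  have e : ∀ᵐ z ∂P,
      ENNReal.ofReal (Real.exp (θ * ((‖y + c • z‖ ^ 2 - (V + c ^ 2)) / W') ^ 2) / √W') =
      ENNReal.ofReal (Real.exp (θ / W' ^ 2 * (D + 2 * c * inner ℝ y z) ^ 2)) *
        ENNReal.ofReal (1 / √W') := by
    filter_upwards [h1] with z hz
    rw [← ENNReal.ofReal_mul (Real.exp_pos _).le, norm_add_sq_real, norm_smul, hz,
      real_inner_smul_right, Real.norm_eq_abs, mul_one, sq_abs]
    rw [mul_one_div]
    congr 3
    rw [hD]
    field_simp
    ring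
  rw [lintegral_congr_ae e, lintegral_mul_const _ (by fun_prop)]
  -- This q satisfies 1 - q = ρ(1 - ρ) = c²W/W'², the variance budget available. It also satisfies q
  -- ≥ ρ, which pays for 1/√q through the growth of √W, and q ≥ ρ², which pays for 1/q in the
  -- exponent.
  have hq : 0 < 1 - ρ + ρ ^ 2 := by nlinarith
  have hqρ : ρ ≤ 1 - ρ + ρ ^ 2 := by nlinarith [sq_nonneg (1 - ρ)]
  have key := lintegral_exp_sq_le P (X := fun z => 2 * c * inner ℝ y z) (by fun_prop)
    (v := 4 * c ^ 2 * (σ ^ 2 * ‖y‖ ^ 2)) (fun l => by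
      have := h.lintegral_exp_le y (l * (2 * c))
      simp_rw [← mul_assoc] at this ⊢
      refine this.trans (le_of_eq ?_)
      congr 2
      ring) (κ := θ / W' ^ 2) (q := 1 - ρ + ρ ^ 2) (by positivity) hq (by
      have h2 : 2 * (θ / W' ^ 2) * (4 * c ^ 2 * (σ ^ 2 * ‖y‖ ^ 2)) ≤
          2 * (θ / W' ^ 2) * (4 * c ^ 2 * (σ ^ 2 * ((1 + ε) * W))) := by gcongr
      have h3 : 2 * (θ / W' ^ 2) * (4 * c ^ 2 * (σ ^ 2 * ((1 + ε) * W))) =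
          (8 * θ * (1 + ε) * σ ^ 2) * (c ^ 2 * W / W' ^ 2) := by ring
      have h4 : (8 * θ * (1 + ε) * σ ^ 2) * (c ^ 2 * W / W' ^ 2) ≤ 1 * (c ^ 2 * W / W' ^ 2) := by
        gcongr
      have h5 : c ^ 2 * W / W' ^ 2 = 1 - (1 - ρ + ρ ^ 2) := by
        rw [hρ, show c ^ 2 = W' - W by rw [hW']; ring]
        field_simp
        ring
      linarith) D
  refine (mul_le_mul_left key _).trans ?_
  rw [← ENNReal.ofReal_mul (by positivity)]
  refine ENNReal.ofReal_le_ofReal ?_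
  rw [div_mul_div_comm, mul_one]
  have hsq : √W ≤ √(1 - ρ + ρ ^ 2) * √W' := by
    rw [← Real.sqrt_mul hq.le]
    apply Real.sqrt_le_sqrt
    calc W = ρ * W' := by rw [hρ]; field_simp
      _ ≤ _ := by gcongr
  have hexp : θ / W' ^ 2 * D ^ 2 / (1 - ρ + ρ ^ 2) ≤ θ * (D / W) ^ 2 := by
    rw [show θ * (D / W) ^ 2 = θ * D ^ 2 / W ^ 2 by ring,
      show θ / W' ^ 2 * D ^ 2 / (1 - ρ + ρ ^ 2) = θ * D ^ 2 / (W' ^ 2 * (1 - ρ + ρ ^ 2)) by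
        field_simp]
    have : W ^ 2 ≤ W' ^ 2 * (1 - ρ + ρ ^ 2) := by
      have e1 : W ^ 2 = W' ^ 2 * ρ ^ 2 := by rw [hρ]; field_simp
      rw [e1]
      gcongr
      linarith
    gcongr
  have hW0 : 0 < √W := Real.sqrt_pos.2 hW
  gcongr

/-- Freezing: the joint law of past and fresh sample is a product, so the sample can be integrated
out with the past held fixed. This replaces conditional expectations. -/
theorem lintegral_comp_of_indep {Ω S E : Type*} {F mΩ : MeasurableSpace Ω} [MeasurableSpace S]
    [MeasurableSpace E] {μ : Measure Ω} [IsProbabilityMeasure μ] {P : Measure E}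
    (hF : F ≤ mΩ) {s : Ω → S} (hs : Measurable[F] s) {z : Ω → E} (hz : Measurable z)
    (hlaw : μ.map z = P)
    (hind : Indep (MeasurableSpace.comap z inferInstance) F μ)
    {f : S × E → ENNReal} (hf : Measurable f) :
    ∫⁻ ω, f (s ω, z ω) ∂μ = ∫⁻ ω, ∫⁻ x, f (s ω, x) ∂P ∂μ := by
  have hs' : Measurable s := hs.mono hF le_rfl
  have hi : IndepFun s z μ := by
    rw [IndepFun_iff_Indep]
    exact (indep_of_indep_of_le_right hind hs.comap_le).symm
  have hmap := (indepFun_iff_map_prod_eq_prod_map_map hs'.aemeasurable hz.aemeasurable).1 hi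
  have : IsProbabilityMeasure P := hlaw ▸ Measure.isProbabilityMeasure_map hz.aemeasurable
  rw [← lintegral_map (f := f) (g := fun ω => (s ω, z ω)) hf (hs'.prodMk hz), hmap, hlaw,
    lintegral_prod _ hf.aemeasurable, lintegral_map (hf.lintegral_prod_right') hs']

/-! ### Adaptive sums of sub-Gaussian unit vectors -/

/-- The sum `∑_{k < n} c_k z_k`. -/
noncomputable def adaptiveSum {Ω E : Type*} [AddCommGroup E] [Module ℝ E] (c : ℕ → Ω → ℝ)
    (z : ℕ → Ω → E) (n : ℕ) (ω : Ω) : E :=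
  ∑ k ∈ Finset.range n, c k ω • z k ω

/-- The sum `∑_{k < n} c_k²`. -/
noncomputable def adaptiveVar {Ω : Type*} (c : ℕ → Ω → ℝ) (n : ℕ) (ω : Ω) : ℝ :=
  ∑ k ∈ Finset.range n, c k ω ^ 2

theorem adaptiveVar_nonneg {Ω : Type*} (c : ℕ → Ω → ℝ) (n : ℕ) (ω : Ω) :
    0 ≤ adaptiveVar c n ω :=
  Finset.sum_nonneg fun _ _ => sq_nonneg _

/-- Up to time `n`, the squared norm of the adaptive sum is within `ε (w + V)` of `V`. -/
def adaptiveGood {Ω E : Type*} [NormedAddCommGroup E] [NormedSpace ℝ E] (c : ℕ → Ω → ℝ)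
    (z : ℕ → Ω → E) (w ε : ℝ) (n : ℕ) : Set Ω :=
  {ω | ∀ k ≤ n, |‖adaptiveSum c z k ω‖ ^ 2 - adaptiveVar c k ω| ≤ ε * (w + adaptiveVar c k ω)}

theorem measurableSet_adaptiveGood {Ω E : Type*} {m : MeasurableSpace Ω} [NormedAddCommGroup E]
    [NormedSpace ℝ E] [MeasurableSpace E] [OpensMeasurableSpace E] {c : ℕ → Ω → ℝ}
    {z : ℕ → Ω → E} {w ε : ℝ} {n : ℕ} (hY : ∀ k ≤ n, Measurable (adaptiveSum c z k))
    (hV : ∀ k ≤ n, Measurable (adaptiveVar c k)) : MeasurableSet (adaptiveGood c z w ε n) := by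
  have : adaptiveGood c z w ε n = ⋂ k ∈ Finset.range (n + 1),
      {ω | |‖adaptiveSum c z k ω‖ ^ 2 - adaptiveVar c k ω| ≤ ε * (w + adaptiveVar c k ω)} := by
    ext ω
    simp [adaptiveGood]
  rw [this]
  refine Finset.measurableSet_biInter _ fun k hk => ?_
  have hk := Finset.mem_range.1 hk
  have h1 := hY k (by omega)
  have h2 := hV k (by omega)
  exact measurableSet_le (by fun_prop) (by fun_prop)

theorem measurable_indicator_one_of_measurableSet {Ω : Type*} {m : MeasurableSpace Ω} {s : Set Ω}
    (hs : MeasurableSet s) : Measurable (s.indicator (1 : Ω → ENNReal)) :=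
  measurable_one.indicator hs

/-- A maximal inequality by stopping at the first failure. The potential starts at 1/√w and is at
least exp(θε²)/√(w + B) on failing; the quotient is the bound. -/
theorem measure_compl_adaptiveGood_le {Ω : Type*} {mΩ : MeasurableSpace Ω} {μ : Measure Ω}
    [IsProbabilityMeasure μ] {M : ℕ} {P : Measure (EuclideanSpace ℝ (Fin M))}
    [IsProbabilityMeasure P] {σ : ℝ≥0} (hsub : IsSubGaussianLaw P σ) (hunit : IsUnitNormLaw P)
    {N : ℕ} {z : ℕ → Ω → EuclideanSpace ℝ (Fin M)} {c : ℕ → Ω → ℝ} {F : ℕ → MeasurableSpace Ω}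
    (hF : ∀ n < N, F n ≤ mΩ) (hzm : ∀ n < N, Measurable (z n))
    (hzF : ∀ n < N, ∀ k < n, Measurable[F n] (z k))
    (hcF : ∀ n < N, ∀ k ≤ n, Measurable[F n] (c k))
    (hlaw : ∀ n < N, μ.map (z n) = P)
    (hind : ∀ n < N, Indep (MeasurableSpace.comap (z n) inferInstance) (F n) μ)
    {w ε θ B : ℝ} (hw : 0 < w) (hε : 0 ≤ ε) (hθ : 0 ≤ θ) (hθσ : 8 * θ * (1 + ε) * σ ^ 2 ≤ 1)
    (hB : ∀ ω, adaptiveVar c N ω ≤ B) :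
    μ (adaptiveGood c z w ε N)ᶜ ≤ ENNReal.ofReal (Real.exp (-(θ * ε ^ 2)) * √((w + B) / w)) := by
  set Y := adaptiveSum c z with hY
  set V := adaptiveVar c with hV
  set G : ℕ → Ω → ENNReal := fun n ω =>
    ENNReal.ofReal (Real.exp (θ * ((‖Y n ω‖ ^ 2 - V n ω) / (w + V n ω)) ^ 2) / √(w + V n ω))
    with hG
  set g : ℝ := Real.exp (θ * ε ^ 2) / √(w + B) with hg
  set A : ℕ → Set Ω := adaptiveGood c z w ε with hA
  have hV0 : ∀ n ω, 0 ≤ V n ω := adaptiveVar_nonneg c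
  have hYF : ∀ n < N, ∀ k ≤ n, Measurable[F n] (Y k) := by
    intro n hn k hk
    refine Finset.measurable_fun_sum _ fun j hj => ?_
    have hj := Finset.mem_range.1 hj
    exact (hcF n hn j (by omega)).smul (hzF n hn j (by omega))
  have hVF : ∀ n < N, ∀ k ≤ n, Measurable[F n] (V k) := by
    intro n hn k hk
    refine Finset.measurable_fun_sum _ fun j hj => ?_
    have hj := Finset.mem_range.1 hj
    exact (hcF n hn j (by omega)).pow_const 2
  have hAF : ∀ n < N, MeasurableSet[F n] (A n) := by
    intro n hn
    exact measurableSet_adaptiveGood (hYF n hn) (hVF n hn)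
  have hYm : ∀ n ≤ N, Measurable (Y n) := by
    intro n hn
    refine Finset.measurable_fun_sum _ fun j hj => ?_
    have hj := Finset.mem_range.1 hj
    exact ((hcF j (by omega) j le_rfl).mono (hF j (by omega)) le_rfl).smul (hzm j (by omega))
  have hVm : ∀ n ≤ N, Measurable (V n) := by
    intro n hn
    refine Finset.measurable_fun_sum _ fun j hj => ?_
    have hj := Finset.mem_range.1 hj
    exact ((hcF j (by omega) j le_rfl).mono (hF j (by omega)) le_rfl).pow_const 2
  have hAm : ∀ n ≤ N, MeasurableSet (A n) := by
    intro n hn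
    exact measurableSet_adaptiveGood (fun k hk => hYm k (hk.trans hn)) fun k hk => hVm k (hk.trans hn)
  have hGm : ∀ n ≤ N, Measurable (G n) := by
    intro n hn
    have h1 := hYm n hn
    have h2 := hVm n hn
    fun_prop
  have hAanti : ∀ n, A (n + 1) ⊆ A n := fun n ω hω k hk => hω k (hk.trans n.le_succ)
  have hVB : ∀ n ≤ N, ∀ ω, V n ω ≤ B := fun n hn ω =>
    (Finset.sum_le_sum_of_subset_of_nonneg (Finset.range_mono hn)
      fun _ _ _ => sq_nonneg _).trans (hB ω)
  -- the potential does not increase on the good event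
  have hstep : ∀ n < N, ∫⁻ ω in A n, G (n + 1) ω ∂μ ≤ ∫⁻ ω in A n, G n ω ∂μ := by
    intro n hn
    -- The indicator of the good event belongs to the frozen state, so that the restriction to `A n`
    -- survives integrating out `z n`.
    let I : Ω → ENNReal := (A n).indicator 1
    have hI : Measurable[F n] I := measurable_indicator_one_of_measurableSet (hAF n hn)
    let f : (EuclideanSpace ℝ (Fin M) × ℝ × ℝ × ENNReal) × EuclideanSpace ℝ (Fin M) → ENNReal :=
      fun p => p.1.2.2.2 * ENNReal.ofReal (Real.exp (θ * ((‖p.1.1 + p.1.2.2.1 • p.2‖ ^ 2 -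
        (p.1.2.1 + p.1.2.2.1 ^ 2)) / (w + p.1.2.1 + p.1.2.2.1 ^ 2)) ^ 2) /
          √(w + p.1.2.1 + p.1.2.2.1 ^ 2))
    have hf : Measurable f := by fun_prop
    have hs : Measurable[F n] fun ω => (Y n ω, V n ω, c n ω, I ω) :=
      (hYF n hn n le_rfl).prodMk ((hVF n hn n le_rfl).prodMk ((hcF n hn n le_rfl).prodMk hI))
    have h1 := lintegral_comp_of_indep (hF n hn) hs (hzm n hn) (hlaw n hn) (hind n hn) hf
    have h2 : ∫⁻ ω in A n, G (n + 1) ω ∂μ = ∫⁻ ω, f ((Y n ω, V n ω, c n ω, I ω), z n ω) ∂μ := by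
      rw [← lintegral_indicator (hAm n hn.le)]
      refine lintegral_congr fun ω => ?_
      have e1 : Y (n + 1) ω = Y n ω + c n ω • z n ω := Finset.sum_range_succ _ _
      have e2 : V (n + 1) ω = V n ω + c n ω ^ 2 := Finset.sum_range_succ _ _
      by_cases hω : ω ∈ A n
      · simp [f, I, hω, hG, e1, e2, add_assoc]
      · simp [f, I, hω]
    rw [h2, h1, ← lintegral_indicator (hAm n hn.le)]
    refine lintegral_mono fun ω => ?_
    by_cases hω : ω ∈ A n
    · simp only [f, I, hω, Set.indicator_of_mem, Pi.one_apply, one_mul, hG]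
      have hWpos : 0 < w + V n ω := by linarith [hV0 n ω]
      refine lintegral_potential_step_le hsub hunit hθ hθσ _ _ _ hWpos ?_
      have := (abs_le.1 (hω n le_rfl)).2
      simp only [← hY, ← hV] at this
      linarith
    · simp [f, I, hω]
  have hbad : ∀ n ≤ N, ∀ ω ∈ A n, ω ∉ A (n + 1) → n + 1 ≤ N →
      ENNReal.ofReal g ≤ G (n + 1) ω := by
    intro n _ ω hω hω' hn
    have : ε * (w + V (n + 1) ω) < |‖Y (n + 1) ω‖ ^ 2 - V (n + 1) ω| := by
      by_contra! hcon
      refine hω' fun k hk => ?_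
      rcases Nat.lt_or_eq_of_le hk with h | rfl
      · exact hω k (by omega)
      · exact hcon
    have hWpos : 0 < w + V (n + 1) ω := by linarith [hV0 (n + 1) ω]
    refine ENNReal.ofReal_le_ofReal ?_
    have h1 : ε ^ 2 ≤ ((‖Y (n + 1) ω‖ ^ 2 - V (n + 1) ω) / (w + V (n + 1) ω)) ^ 2 := by
      rw [← sq_abs (_ / _), abs_div, abs_of_pos hWpos]
      gcongr
      rw [le_div_iff₀ hWpos]
      exact this.le
    have h2 := hVB (n + 1) hn ω
    have h3 : 0 < √(w + V (n + 1) ω) := Real.sqrt_pos.2 hWpos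
    rw [hg]
    gcongr
  -- The invariant of the stopped process: paths that have failed are charged the constant g, the
  -- others their current potential.
  have hmain : ∀ n ≤ N, ENNReal.ofReal g * μ (A n)ᶜ + ∫⁻ ω in A n, G n ω ∂μ ≤
      ENNReal.ofReal (1 / √w) := by
    intro n
    induction n with
    | zero =>
      intro _
      have hA0 : A 0 = Set.univ := by
        ext ω
        simp [hA, adaptiveGood, adaptiveSum, adaptiveVar]
        positivity
      simp [hA0, hG, hY, hV, adaptiveSum, adaptiveVar]
    | succ n ih =>
      intro hn
      refine le_trans ?_ (ih (by omega))
      have hd : (A (n + 1))ᶜ = (A n)ᶜ ∪ (A n \ A (n + 1)) := by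
        ext ω
        have := @hAanti n ω
        simp only [Set.mem_compl_iff, Set.mem_union, Set.mem_sdiff]
        tauto
      have hm1 := hAm n (by omega)
      have hm2 := hAm (n + 1) hn
      have e1 : ∫⁻ ω in A n, G (n + 1) ω ∂μ =
          ∫⁻ ω in A n \ A (n + 1), G (n + 1) ω ∂μ + ∫⁻ ω in A (n + 1), G (n + 1) ω ∂μ := by
        rw [← lintegral_union hm2 Set.disjoint_sdiff_left, Set.sdiff_union_of_subset (hAanti n)]
      have e2 : ENNReal.ofReal g * μ (A n \ A (n + 1)) ≤
          ∫⁻ ω in A n \ A (n + 1), G (n + 1) ω ∂μ := by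
        rw [← setLIntegral_const]
        exact setLIntegral_mono (hGm _ hn) fun ω hω => hbad n (by omega) ω hω.1 hω.2 hn
      calc _ ≤ ENNReal.ofReal g * (μ (A n)ᶜ + μ (A n \ A (n + 1))) +
            ∫⁻ ω in A (n + 1), G (n + 1) ω ∂μ := by
              rw [hd]
              gcongr
              exact measure_union_le _ _
        _ ≤ ENNReal.ofReal g * μ (A n)ᶜ + ∫⁻ ω in A n, G (n + 1) ω ∂μ := by
              rw [mul_add, e1, add_assoc]
              gcongr
        _ ≤ _ := by
              gcongr 1
              exact hstep n (by omega)
  have hfin : ENNReal.ofReal g * μ (A N)ᶜ ≤ ENNReal.ofReal (1 / √w) :=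
    le_self_add.trans (hmain N le_rfl)
  have hB0 : 0 ≤ B := by
    obtain ⟨ω⟩ := μ.nonempty_of_neZero
    exact (hV0 N ω).trans (hB ω)
  have hg0 : 0 < g := by positivity
  rw [mul_comm, ← ENNReal.le_div_iff_mul_le (by simp [hg0]) (by simp),
    ← ENNReal.ofReal_div_of_pos hg0] at hfin
  refine hfin.trans (le_of_eq ?_)
  congr 1
  rw [hg, Real.exp_neg, Real.sqrt_div (by positivity)]
  field_simp

/-! ### Nets of the unit sphere and quadratic forms -/

/-- Volume packing: the balls of radius r/2 around the points are disjoint and lie in the ball of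
radius 1 + r/2. -/
theorem card_le_of_separated_unit_ball {E : Type*} [NormedAddCommGroup E] [NormedSpace ℝ E]
    [FiniteDimensional ℝ E] {r : ℝ} (hr : 0 < r) (s : Finset E) (hs : ∀ c ∈ s, ‖c‖ ≤ 1)
    (h : ∀ c ∈ s, ∀ b ∈ s, c ≠ b → r ≤ ‖c - b‖) :
    (s.card : ℝ) ≤ (1 + 2 / r) ^ Module.finrank ℝ E := by
  borelize E
  let μ : Measure E := Measure.addHaar
  have hρ : 0 < 1 + r / 2 := by positivity
  have hr2 : 0 < r / 2 := by positivity
  have hdisj : Set.PairwiseDisjoint (s : Set E) fun c => Metric.ball c (r / 2) := by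
    intro c hc b hb hcb
    apply Metric.ball_disjoint_ball
    rw [dist_eq_norm]
    linarith [h c hc b hb hcb]
  have hsub : (⋃ c ∈ s, Metric.ball c (r / 2)) ⊆ Metric.ball (0 : E) (1 + r / 2) := by
    refine Set.iUnion₂_subset fun c hc => Metric.ball_subset_ball' ?_
    rw [dist_zero_right]
    linarith [hs c hc]
  have h1 : (s.card : ENNReal) * ENNReal.ofReal ((r / 2) ^ Module.finrank ℝ E) *
      μ (Metric.ball 0 1) ≤ ENNReal.ofReal ((1 + r / 2) ^ Module.finrank ℝ E) *
        μ (Metric.ball 0 1) := by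
    calc _ = μ (⋃ c ∈ s, Metric.ball c (r / 2)) := by
          rw [measure_biUnion_finset hdisj fun c _ => measurableSet_ball]
          simp only [μ.addHaar_ball_of_pos _ hr2, Finset.sum_const, nsmul_eq_mul, mul_assoc]
      _ ≤ μ (Metric.ball 0 (1 + r / 2)) := measure_mono hsub
      _ = _ := μ.addHaar_ball_of_pos _ hρ
  have h2 := (ENNReal.mul_le_mul_iff_left
    (Metric.measure_ball_pos _ _ zero_lt_one).ne' measure_ball_lt_top.ne).1 h1
  have h3 := ENNReal.toReal_le_of_le_ofReal (pow_nonneg hρ.le _) h2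
  rw [ENNReal.toReal_mul, ENNReal.toReal_natCast, ENNReal.toReal_ofReal (by positivity),
    ← le_div_iff₀ (by positivity), ← div_pow] at h3
  have e : (1 + r / 2) / (r / 2) = 1 + 2 / r := by
    field_simp
    ring
  rwa [e] at h3

/-- A separated set of maximal cardinality is a net, since an uncovered point could be added. -/
theorem exists_finset_net_sphere (E : Type*) [NormedAddCommGroup E] [NormedSpace ℝ E]
    [FiniteDimensional ℝ E] {r : ℝ} (hr : 0 < r) :
    ∃ s : Finset E, (∀ b ∈ s, ‖b‖ = 1) ∧ (∀ a : E, ‖a‖ = 1 → ∃ b ∈ s, ‖a - b‖ ≤ r) ∧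
      (s.card : ℝ) ≤ (1 + 2 / r) ^ Module.finrank ℝ E := by
  classical
  let C : Set ℕ := {n | ∃ s : Finset E, (∀ b ∈ s, ‖b‖ = 1) ∧
    (∀ c ∈ s, ∀ b ∈ s, c ≠ b → r ≤ ‖c - b‖) ∧ s.card = n}
  have hne : C.Nonempty := ⟨0, ∅, by simp⟩
  have hbdd : BddAbove C := by
    refine ⟨⌊(1 + 2 / r) ^ Module.finrank ℝ E⌋₊, ?_⟩
    rintro n ⟨s, h1, h2, rfl⟩
    exact Nat.le_floor (card_le_of_separated_unit_ball hr s (fun c hc => (h1 c hc).le) h2)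
  obtain ⟨s, h1, h2, h3⟩ := Nat.sSup_mem hne hbdd
  refine ⟨s, h1, fun a ha => ?_,
    card_le_of_separated_unit_ball hr s (fun c hc => (h1 c hc).le) h2⟩
  by_contra! hcon
  have has : a ∉ s := fun h => by
    have := hcon a h
    simp at this
    linarith
  have : s.card + 1 ∈ C := by
    refine ⟨insert a s, ?_, ?_, Finset.card_insert_of_notMem has⟩
    · simpa using ⟨ha, h1⟩
    · intro c hc b hb hcb
      rcases Finset.mem_insert.1 hc with rfl | hc' <;>
        rcases Finset.mem_insert.1 hb with rfl | hb'
      · exact absurd rfl hcb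
      · exact (hcon b hb').le
      · rw [norm_sub_rev]
        exact (hcon c hc').le
      · exact h2 c hc' b hb' hcb
  have := le_csSup hbdd this
  omega

/-- A symmetric form that is small relative to `Q` on a net of the unit sphere is small relative
to `Q` in all directions. -/
theorem abs_form_le_of_net {E : Type*} [NormedAddCommGroup E] [NormedSpace ℝ E]
    [FiniteDimensional ℝ E] {B Q : LinearMap.BilinForm ℝ E} (hB : ∀ x y, B x y = B y x)
    (hQ : ∀ x y, Q x y = Q y x) (hBc : Continuous fun x => B x x)
    (hQc : Continuous fun x => Q x x) {α β r : ℝ} (hα : 0 < α)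
    (hαQ : ∀ x, α * ‖x‖ ^ 2 ≤ Q x x) (hQβ : ∀ x, Q x x ≤ β * ‖x‖ ^ 2)
    (hr : β * r ^ 2 ≤ α / 576) {s : Finset E}
    (hnet : ∀ a : E, ‖a‖ = 1 → ∃ b ∈ s, ‖a - b‖ ≤ r)
    (hsB : ∀ b ∈ s, |B b b| ≤ 3 / 8 * Q b b) (x : E) : |B x x| ≤ 1 / 2 * Q x x := by
  by_cases hx : x = 0
  · simp [hx]
  have hQ0 : ∀ x, 0 ≤ Q x x := fun x => (by positivity : (0 : ℝ) ≤ α * ‖x‖ ^ 2).trans (hαQ x)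
  have hQpos : ∀ x, ‖x‖ = 1 → 0 < Q x x := fun x hx => by
    have := hαQ x
    rw [hx] at this
    linarith
  have hunit : ∀ x : E, x ≠ 0 → ‖(‖x‖)⁻¹ • x‖ = 1 := fun x hx => by
    rw [norm_smul, norm_inv, norm_norm, inv_mul_cancel₀ (norm_ne_zero_iff.2 hx)]
  have hcomp : IsCompact (Metric.sphere (0 : E) 1) := isCompact_sphere 0 1
  -- The largest ratio K, attained at a, also controls the error of moving from a to a net point b.
  -- The result is K ≤ (3/8)(25/24)² + K/10, hence K ≤ 1/2.
  obtain ⟨a, ha, hmax⟩ := hcomp.exists_isMaxOn ⟨(‖x‖)⁻¹ • x, by simpa using hunit x hx⟩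
    (f := fun x => |B x x| / Q x x)
    (hBc.abs.continuousOn.div hQc.continuousOn fun y hy => (hQpos y (by simpa using hy)).ne')
  have ha1 : ‖a‖ = 1 := by simpa using ha
  set K := |B a a| / Q a a with hK
  have hK0 : 0 ≤ K := div_nonneg (abs_nonneg _) (hQ0 a)
  have hBK : ∀ y, |B y y| ≤ K * Q y y := by
    intro y
    by_cases hy : y = 0
    · simp [hy]
    have h1 : |B ((‖y‖)⁻¹ • y) ((‖y‖)⁻¹ • y)| / Q ((‖y‖)⁻¹ • y) ((‖y‖)⁻¹ • y) ≤ K :=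
      hmax (show (‖y‖)⁻¹ • y ∈ Metric.sphere (0 : E) 1 by simpa using hunit y hy)
    rw [div_le_iff₀ (hQpos _ (hunit y hy))] at h1
    have hyn : 0 < ‖y‖ := norm_pos_iff.2 hy
    simp only [map_smul, LinearMap.smul_apply, smul_eq_mul, abs_mul, abs_inv, abs_norm] at h1
    have h2 := mul_le_mul_of_nonneg_left h1 (sq_nonneg ‖y‖)
    have e : ∀ t : ℝ, ‖y‖ ^ 2 * (‖y‖⁻¹ * (‖y‖⁻¹ * t)) = t := fun t => by field_simp
    rwa [mul_left_comm _ K, e, e] at h2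
  have h4 : |B a a| = K * Q a a := (div_mul_cancel₀ _ (hQpos a ha1).ne').symm
  clear_value K
  suffices K ≤ 1 / 2 from (hBK x).trans (mul_le_mul_of_nonneg_right this (hQ0 x))
  obtain ⟨b, hb, hab⟩ := hnet a ha1
  have hr0 : 0 ≤ r := (norm_nonneg _).trans hab
  set u := a - b with hu
  have hβ : 0 ≤ β := by
    have := (hQpos a ha1).le.trans (hQβ a)
    simpa [ha1] using this
  have hQu : Q u u ≤ Q a a / 576 := by
    have h1 : Q u u ≤ β * r ^ 2 := (hQβ u).trans (by gcongr)
    have h2 := hαQ a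
    rw [ha1] at h2
    linarith
  have hb' : b = a - u := by rw [hu]; abel
  -- the weighted inequality between the arithmetic and the geometric mean
  have hQb : Q b b ≤ 625 / 576 * Q a a := by
    have h1 := hQ0 ((1 / 24 : ℝ) • a + u)
    rw [hb']
    simp only [map_add, map_sub, map_smul, LinearMap.add_apply, LinearMap.sub_apply,
      LinearMap.smul_apply, smul_eq_mul, hQ u a] at h1 ⊢
    linarith
  have hBu : |B a a| ≤ |B b b| + |B u (a + b)| := by
    have : B a a = B b b + B u (a + b) := by
      simp only [hu, map_add, map_sub, LinearMap.sub_apply, hB b a]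
      ring
    rw [this]
    exact abs_add_le _ _
  have hv : Q (a + b) (a + b) ≤ 2 * Q a a + 2 * Q b b := by
    have := hQ0 u
    simp only [hu, map_add, map_sub, LinearMap.sub_apply, LinearMap.add_apply, hQ b a] at this ⊢
    linarith
  -- Polarization with 48u ± v. The weight 48 balances the two terms: in the norm of Q, u has length
  -- at most 1/24 of that of a, while v is about 2a.
  have hBuv : |B u (a + b)| ≤ K / 4 * (96 * Q u u + 1 / 24 * Q (a + b) (a + b)) := by
    set v := a + b
    have h1 := abs_le.1 (hBK ((48 : ℝ) • u + v))
    have h2 := abs_le.1 (hBK ((48 : ℝ) • u - v))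
    simp only [map_add, map_sub, map_smul, LinearMap.add_apply, LinearMap.sub_apply,
      LinearMap.smul_apply, smul_eq_mul, hQ v u, hB v u] at h1 h2
    rw [abs_le]
    constructor <;> linarith [h1.1, h1.2, h2.1, h2.2]
  have h3 := hsB b hb
  have h5 : K / 4 * (96 * Q u u + 1 / 24 * Q (a + b) (a + b)) ≤ K / 10 * Q a a := by
    have : 1 / 4 * (96 * Q u u + 1 / 24 * Q (a + b) (a + b)) ≤ 1 / 10 * Q a a := by
      linarith [hQ0 a]
    have := mul_le_mul_of_nonneg_left this hK0
    linarith
  have h6 : K * Q a a ≤ 3 / 8 * (625 / 576) * Q a a + K / 10 * Q a a := by linarith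
  have h7 : (K - K / 10 - 3 / 8 * (625 / 576)) * Q a a ≤ 0 := by linarith
  have h8 := nonpos_of_mul_nonpos_left h7 (hQpos a ha1)
  linarith

/-! ### The update procedure -/

theorem Matrix.PosDef.add_vecMulVec_self {n : Type*} [Fintype n] {A : Matrix n n ℝ}
    (hA : A.PosDef) (x : n → ℝ) : (A + Matrix.vecMulVec x x).PosDef := by
  have := Matrix.posSemidef_vecMulVec_self_star x
  rw [star_trivial] at this
  exact hA.add_posSemidef this

/-- The Sherman–Morrison formula for a positive definite matrix. -/
theorem Matrix.PosDef.inv_add_vecMulVec_self {n : Type*} [Fintype n] [DecidableEq n]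
    {A : Matrix n n ℝ} (hA : A.PosDef) (x : n → ℝ) :
    (A + Matrix.vecMulVec x x)⁻¹ =
      A⁻¹ - (1 + x ⬝ᵥ A⁻¹ *ᵥ x)⁻¹ • Matrix.vecMulVec (A⁻¹ *ᵥ x) (x ᵥ* A⁻¹) := by
  have hq : 0 ≤ x ⬝ᵥ A⁻¹ *ᵥ x := by
    simpa using hA.inv.posSemidef.dotProduct_mulVec_nonneg x
  have hc : 1 + x ⬝ᵥ A⁻¹ *ᵥ x ≠ 0 := by positivity
  have hu : IsUnit A.det := (Matrix.isUnit_iff_isUnit_det A).1 hA.isUnit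
  apply Matrix.inv_eq_right_inv
  rw [mul_sub, add_mul, Matrix.mul_smul, add_mul, Matrix.mul_nonsing_inv A hu,
    Matrix.mul_vecMulVec, Matrix.mulVec_mulVec, Matrix.mul_nonsing_inv A hu, Matrix.one_mulVec,
    Matrix.vecMulVec_mul, Matrix.vecMulVec_mul_vecMulVec, Matrix.vecMulVec_smul]
  have : Matrix.vecMulVec x (x ᵥ* A⁻¹) =
      (1 + x ⬝ᵥ A⁻¹ *ᵥ x)⁻¹ • (Matrix.vecMulVec x (x ᵥ* A⁻¹) +
        (x ⬝ᵥ A⁻¹ *ᵥ x) • Matrix.vecMulVec x (x ᵥ* A⁻¹)) := by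
    rw [show ∀ N : Matrix n n ℝ, N + (x ⬝ᵥ A⁻¹ *ᵥ x) • N = (1 + x ⬝ᵥ A⁻¹ *ᵥ x) • N from
      fun N => by rw [add_smul, one_smul], smul_smul, inv_mul_cancel₀ hc, one_smul]
  rw [← this]
  abel

namespace BanditRun

variable {Ω 𝒜 : Type*} {d M : ℕ} (R : BanditRun Ω 𝒜 d M) {S₀ : Matrix (Fin d) (Fin d) ℝ}

theorem posDef_precision (hS : S₀.PosDef) (t : ℕ) (ω : Ω) : (R.precision S₀ t ω).PosDef := by
  induction t with
  | zero => exact hS.inv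
  | succ t ih => exact ih.add_vecMulVec_self _

theorem isUnit_det_precision (hS : S₀.PosDef) (t : ℕ) (ω : Ω) :
    IsUnit (R.precision S₀ t ω).det :=
  (Matrix.isUnit_iff_isUnit_det _).1 (R.posDef_precision hS t ω).isUnit

theorem incrementalUpdate_val (hS : S₀.PosDef) (t : ℕ) (ω : Ω) :
    (incrementalUpdate (R.updateState S₀ t ω) (R.feature (t + 1) ω)
      (R.pertVec (t + 1) ω)).val = R.updateState S₀ (t + 1) ω := by
  set x := R.feature (t + 1) ω with hx
  have hcov : (Matrix.of fun i j => R.covariance S₀ t ω i j -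
      (∑ k, R.covariance S₀ t ω i k * x k) * (∑ k, x k * R.covariance S₀ t ω k j) /
        (1 + ∑ i, x i * ∑ k, R.covariance S₀ t ω i k * x k)) = R.covariance S₀ (t + 1) ω := by
    have h := (R.posDef_precision hS t ω).inv_add_vecMulVec_self x
    refine Eq.trans ?_ h.symm
    ext i j
    simp only [Matrix.of_apply, Matrix.sub_apply, Matrix.smul_apply, Matrix.vecMulVec_apply,
      Matrix.mulVec, Matrix.vecMul, dotProduct, covariance, smul_eq_mul]
    ring
  -- Forgetting the counter, the procedure unfolds definitionally to these matrix expressions.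
  have hval : (incrementalUpdate (R.updateState S₀ t ω) x (R.pertVec (t + 1) ω)).val =
      ⟨R.precision S₀ t ω + Matrix.vecMulVec x x,
        Matrix.of fun i j => R.covariance S₀ t ω i j -
          (∑ k, R.covariance S₀ t ω i k * x k) * (∑ k, x k * R.covariance S₀ t ω k j) /
          (1 + ∑ i, x i * ∑ k, R.covariance S₀ t ω i k * x k),
        (Matrix.of fun i j => R.covariance S₀ t ω i j -
          (∑ k, R.covariance S₀ t ω i k * x k) * (∑ k, x k * R.covariance S₀ t ω k j) /
          (1 + ∑ i, x i * ∑ k, R.covariance S₀ t ω i k * x k)) *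
        (R.precision S₀ t ω * R.factor S₀ t ω +
          Matrix.vecMulVec x (R.pertVec (t + 1) ω))⟩ := rfl
  rw [hval, hcov]
  rfl

end BanditRun

theorem incrementalUpdate_ops {d M : ℕ} (st : UpdateState d M) (x : Fin d → ℝ) (z : Fin M → ℝ) :
    (incrementalUpdate st x z).ops =
      9 * d ^ 2 + 2 * d + 1 + 4 * (d ^ 2 * M) + 2 * (d * M) := by
  simp only [incrementalUpdate, bind, pure, Counted.vector, Counted.matrix, Counted.dot,
    Counted.sum, Counted.mul, Counted.add, Counted.sub, Counted.div, Counted.matMul,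
    Finset.sum_const, Finset.card_univ, Fintype.card_fin, smul_eq_mul]
  ring

/-! ### The order of the threshold -/

/-- Bernoulli's inequality for exponents at most 1; this is why 48/s is truncated at 1 in the lower
bound for the threshold. -/
theorem log_one_add_mul_sqrt_ge {a : ℝ} (ha : 0 < a) (ha1 : a ≤ 1) {T : ℝ} (hT : 1 ≤ T) :
    a / 2 * Real.log T ≤ Real.log (1 + a * √T) := by
  have hT0 : 0 < T := by linarith
  have h1 : (1 + √T) ^ a ≤ 1 + a * √T :=
    rpow_one_add_le_one_add_mul_self (by linarith [Real.sqrt_nonneg T]) ha.le ha1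
  have hs : 0 < √T := Real.sqrt_pos.2 hT0
  calc a / 2 * Real.log T = a * Real.log √T := by rw [Real.log_sqrt hT0.le]; ring
    _ ≤ a * Real.log (1 + √T) := by gcongr; linarith
    _ = Real.log ((1 + √T) ^ a) := (Real.log_rpow (by positivity) _).symm
    _ ≤ _ := Real.log_le_log (by positivity) h1

theorem indexDimBound_ge {s s' δ : ℝ} (hs : 0 < s) (hδ : 0 < δ) (hδ1 : δ < 1)
    {d T : ℕ} (hT : 2 ≤ T) :
    160 * min 1 (48 / s) * (d * Real.log T) ≤ indexDimBound d T s s' δ := by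
  have hT' : (1 : ℝ) ≤ T := by exact_mod_cast (by omega : 1 ≤ T)
  set a := min 1 (48 / s)
  have ha : 0 < a := lt_min one_pos (by positivity)
  have h1 := log_one_add_mul_sqrt_ge ha (min_le_left _ _) hT'
  have h2 : 1 + a * √T ≤ (1 + 48 / s * √(s' ^ 2 + T)) / δ := by
    rw [le_div_iff₀ hδ]
    have h3 : a * √T ≤ 48 / s * √(s' ^ 2 + T) := by
      gcongr
      · exact min_le_right _ _
      · nlinarith [sq_nonneg s']
    have h4 : 0 ≤ a * √T := by positivity
    nlinarith
  have h5 := h1.trans (Real.log_le_log (by positivity) h2)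
  have h6 : 0 ≤ Real.log (1 + T / s ^ 2) := Real.log_nonneg (by
    have : 0 ≤ (T : ℝ) / s ^ 2 := by positivity
    linarith)
  have h7 := mul_le_mul_of_nonneg_left h5 (Nat.cast_nonneg (α := ℝ) d)
  rw [indexDimBound]
  linarith

/-- As T ≥ 2, the additive constant log C is absorbed into a multiple of log T. -/
theorem log_le_mul_log {C T : ℝ} (hC : 1 ≤ C) (hT : 2 ≤ T) {y : ℝ} (hy : 0 < y) (h : y ≤ C * T) :
    Real.log y ≤ (Real.log C / Real.log 2 + 1) * Real.log T := by
  have h1 : 0 < Real.log 2 := Real.log_pos one_lt_two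
  have h2 : Real.log 2 ≤ Real.log T := Real.log_le_log two_pos hT
  have h3 : 0 ≤ Real.log C := Real.log_nonneg hC
  calc Real.log y ≤ Real.log (C * T) := Real.log_le_log hy h
    _ = Real.log C + Real.log T := Real.log_mul (by positivity) (by positivity)
    _ = Real.log C / Real.log 2 * Real.log 2 + Real.log T := by field_simp
    _ ≤ Real.log C / Real.log 2 * Real.log T + Real.log T := by gcongr
    _ = _ := by ring

theorem exists_indexDimBound_le {s s' δ : ℝ} (hs : 0 < s) (hδ : 0 < δ) (hδ1 : δ < 1) :
    ∃ C : ℝ, 0 < C ∧ ∀ d T : ℕ, 1 ≤ d → 2 ≤ T →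
      indexDimBound d T s s' δ ≤ C * (d * Real.log T) := by
  set C₁ := (1 + 48 / s * √(s' ^ 2 + 1)) / δ with hC₁
  set C₂ := 1 + 1 / s ^ 2 with hC₂
  have h1 : 1 ≤ C₁ := by
    rw [hC₁, le_div_iff₀ hδ]
    have : 0 ≤ 48 / s * √(s' ^ 2 + 1) := by positivity
    linarith
  have h2 : 1 ≤ C₂ := by
    have : 0 ≤ 1 / s ^ 2 := by positivity
    linarith
  have hl : 0 < Real.log 2 := Real.log_pos one_lt_two
  have h1' := Real.log_nonneg h1
  have h2' := Real.log_nonneg h2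
  refine ⟨320 * ((Real.log C₁ / Real.log 2 + 1) + (Real.log C₂ / Real.log 2 + 1)),
    by positivity, fun d T hd hT => ?_⟩
  have hd' : (1 : ℝ) ≤ d := by exact_mod_cast hd
  have hT' : (2 : ℝ) ≤ T := by exact_mod_cast hT
  have hlT : 0 ≤ Real.log T := Real.log_nonneg (by linarith)
  have h3 := log_le_mul_log h1 hT' (y := (1 + 48 / s * √(s' ^ 2 + T)) / δ) (by positivity) (by
    rw [hC₁, div_mul_eq_mul_div _ δ]
    gcongr
    have h4 : √(s' ^ 2 + T) ≤ √(s' ^ 2 + 1) * T := by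
      rw [Real.sqrt_le_left (by positivity), mul_pow, Real.sq_sqrt (by positivity)]
      have h4 : (T : ℝ) ≤ T ^ 2 := by nlinarith
      have h5 : s' ^ 2 * 1 ≤ s' ^ 2 * T ^ 2 := by gcongr; linarith
      linarith
    have h5 : 48 / s * √(s' ^ 2 + T) ≤ 48 / s * (√(s' ^ 2 + 1) * T) := by gcongr
    linarith)
  have h6 := log_le_mul_log h2 hT' (y := 1 + T / s ^ 2) (by positivity) (by
    rw [hC₂, add_mul, one_div_mul_eq_div]
    linarith)
  have h7 := mul_le_mul_of_nonneg_left h3 (Nat.cast_nonneg (α := ℝ) d)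
  have h8 : (Real.log C₂ / Real.log 2 + 1) * Real.log T ≤
      d * ((Real.log C₂ / Real.log 2 + 1) * Real.log T) :=
    le_mul_of_one_le_left (by positivity) hd'
  rw [indexDimBound]
  linarith

theorem exists_threshold_order_and_ops_le {s s' δ : ℝ} (hs : 0 < s) (hδ : 0 < δ)
    (hδ1 : δ < 1) :
    ∃ c C K : ℝ, 0 < c ∧ 0 < C ∧ 0 < K ∧ ∀ d T : ℕ, 1 ≤ d → 2 ≤ T →
      c * (d * Real.log T) ≤ indexDimBound d T s s' δ ∧
      indexDimBound d T s s' δ ≤ C * (d * Real.log T) ∧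
      ∀ (st : UpdateState d ⌈indexDimBound d T s s' δ⌉₊) (x : Fin d → ℝ)
        (z : Fin ⌈indexDimBound d T s s' δ⌉₊ → ℝ),
        ((incrementalUpdate st x z).ops : ℝ) ≤ K * (d ^ 3 * Real.log T) := by
  obtain ⟨C, hC, h⟩ := exists_indexDimBound_le (s' := s') hs hδ hδ1
  have hl : 0 < Real.log 2 := Real.log_pos one_lt_two
  -- The terms free of M are at most 12d³ and those with M at most 6d²M, where M ≤ C d log T + 1.
  -- The resulting 18d³ is absorbed using log T ≥ log 2.
  refine ⟨160 * min 1 (48 / s), C, 6 * C + 18 / Real.log 2,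
    mul_pos (by norm_num) (lt_min one_pos (by positivity)), hC, by positivity,
    fun d T hd hT => ⟨indexDimBound_ge hs hδ hδ1 hT, h d T hd hT, fun st x z => ?_⟩⟩
  have hlow := indexDimBound_ge (s' := s') hs hδ hδ1 (d := d) hT
  have hup := h d T hd hT
  have hd' : (1 : ℝ) ≤ d := by exact_mod_cast hd
  have hT' : (2 : ℝ) ≤ T := by exact_mod_cast hT
  have hlT : Real.log 2 ≤ Real.log T := Real.log_le_log two_pos hT'
  have hlT0 : 0 < Real.log T := hl.trans_le hlT
  have h0 : 0 ≤ indexDimBound d T s s' δ :=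
    (mul_nonneg (mul_nonneg (by norm_num) (le_min zero_le_one (by positivity)))
      (by positivity)).trans hlow
  rw [incrementalUpdate_ops]
  have hM := (Nat.ceil_lt_add_one h0).le
  set M := ⌈indexDimBound d T s s' δ⌉₊
  have hMle : (M : ℝ) ≤ C * (d * Real.log T) + 1 := by linarith
  have hd2 : (d : ℝ) ≤ d ^ 2 := by nlinarith
  have hd21 : (1 : ℝ) ≤ d ^ 2 := by linarith
  have hd3 : (d : ℝ) ^ 2 ≤ d ^ 3 := by nlinarith [sq_nonneg (d : ℝ)]
  have hM0 : (0 : ℝ) ≤ M := by positivity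
  have e1 : (d : ℝ) * M ≤ d ^ 2 * M := by gcongr
  have e2 : (d : ℝ) ^ 2 * M ≤ d ^ 2 * (C * (d * Real.log T) + 1) := by gcongr
  have e3 : (d : ℝ) ^ 3 ≤ d ^ 3 * (Real.log T / Real.log 2) :=
    le_mul_of_one_le_right (by positivity) ((one_le_div hl).2 hlT)
  have e4 : (6 * C + 18 / Real.log 2) * (d ^ 3 * Real.log T) =
      6 * (d ^ 2 * (C * (d * Real.log T))) + 18 * (d ^ 3 * (Real.log T / Real.log 2)) := by ring
  push_cast
  rw [e4]
  linarith

/-! ### The extreme values of the initial precision -/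

/-- The bilinear form `xᵀ H y` on Euclidean space. -/
noncomputable def Matrix.euclideanForm {d : ℕ} (H : Matrix (Fin d) (Fin d) ℝ) :
    LinearMap.BilinForm ℝ (EuclideanSpace ℝ (Fin d)) :=
  LinearMap.mk₂ ℝ (fun x y => x.ofLp ⬝ᵥ H *ᵥ y.ofLp)
    (fun _ _ _ => by simp [add_dotProduct]) (fun _ _ _ => by simp [smul_dotProduct])
    (fun _ _ _ => by simp [Matrix.mulVec_add, dotProduct_add])
    (fun _ _ _ => by simp [Matrix.mulVec_smul, dotProduct_smul])

theorem Matrix.euclideanForm_apply {d : ℕ} (H : Matrix (Fin d) (Fin d) ℝ)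
    (x y : EuclideanSpace ℝ (Fin d)) : H.euclideanForm x y = x.ofLp ⬝ᵥ H *ᵥ y.ofLp := rfl

theorem Matrix.continuous_euclideanForm_self {d : ℕ} (H : Matrix (Fin d) (Fin d) ℝ) :
    Continuous fun x => H.euclideanForm x x := by
  simp only [Matrix.euclideanForm_apply, dotProduct, Matrix.mulVec]
  fun_prop

theorem Matrix.euclideanForm_comm {d : ℕ} {H : Matrix (Fin d) (Fin d) ℝ} (hH : Hᵀ = H)
    (x y : EuclideanSpace ℝ (Fin d)) : H.euclideanForm x y = H.euclideanForm y x := by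
  rw [Matrix.euclideanForm_apply, Matrix.euclideanForm_apply, dotProduct_comm,
    Matrix.dotProduct_mulVec, ← Matrix.mulVec_transpose, hH]

theorem Matrix.transpose_cfcSqrt {d : ℕ} (S : Matrix (Fin d) (Fin d) ℝ) : (CFC.sqrt S)ᵀ = CFC.sqrt S := by
  have := (CFC.sqrt_nonneg S).isSelfAdjoint
  rwa [isSelfAdjoint_iff, Matrix.star_eq_conjTranspose,
    Matrix.conjTranspose_eq_transpose_of_trivial] at this

theorem Matrix.PosDef.inv_mul_sqrt_mul_transpose {d : ℕ} {S₀ : Matrix (Fin d) (Fin d) ℝ}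
    (hS : S₀.PosDef) :
    (S₀⁻¹ * CFC.sqrt S₀) * (S₀⁻¹ * CFC.sqrt S₀)ᵀ = S₀⁻¹ := by
  have hT : S₀ᵀ = S₀ := by
    simpa [Matrix.conjTranspose_eq_transpose_of_trivial] using hS.isHermitian.eq
  have hu : IsUnit S₀.det := (Matrix.isUnit_iff_isUnit_det _).1 hS.isUnit
  rw [Matrix.transpose_mul, Matrix.transpose_cfcSqrt, Matrix.transpose_nonsing_inv, hT, Matrix.mul_assoc,
    ← Matrix.mul_assoc (CFC.sqrt S₀), CFC.sqrt_mul_sqrt_self S₀ hS.posSemidef.nonneg,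
    ← Matrix.mul_assoc, Matrix.nonsing_inv_mul _ hu, Matrix.one_mul]

section Extremes

variable {d : ℕ} {S₀ : Matrix (Fin d) (Fin d) ℝ}

theorem bddBelow_range_form (hS : S₀.PosDef) :
    BddBelow (Set.range fun a : Metric.sphere (0 : EuclideanSpace ℝ (Fin d)) 1 =>
      (a : EuclideanSpace ℝ (Fin d)).ofLp ⬝ᵥ S₀⁻¹ *ᵥ (a : EuclideanSpace ℝ (Fin d)).ofLp) := by
  refine ⟨0, ?_⟩
  rintro _ ⟨a, rfl⟩
  simpa using hS.inv.posSemidef.dotProduct_mulVec_nonneg (a : EuclideanSpace ℝ (Fin d)).ofLp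

theorem bddAbove_range_form :
    BddAbove (Set.range fun a : Metric.sphere (0 : EuclideanSpace ℝ (Fin d)) 1 =>
      (a : EuclideanSpace ℝ (Fin d)).ofLp ⬝ᵥ S₀⁻¹ *ᵥ (a : EuclideanSpace ℝ (Fin d)).ofLp) :=
  (isCompact_range (S₀⁻¹.continuous_euclideanForm_self.comp continuous_subtype_val)).bddAbove

theorem sMin_pos (hd : 1 ≤ d) (hS : S₀.PosDef) : 0 < sMin S₀ := by
  have : Nonempty (Fin d) := ⟨⟨0, hd⟩⟩
  have hne : (Metric.sphere (0 : EuclideanSpace ℝ (Fin d)) 1).Nonempty :=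
    NormedSpace.sphere_nonempty.2 zero_le_one
  have := hne.to_subtype
  obtain ⟨a, ha, hmin⟩ := (isCompact_sphere (0 : EuclideanSpace ℝ (Fin d)) 1).exists_isMinOn hne
    S₀⁻¹.continuous_euclideanForm_self.continuousOn
  have ha0 : a.ofLp ≠ 0 := fun h => by
    have h0 : a = 0 := (WithLp.ofLp_eq_zero 2).1 h
    rw [h0] at ha
    simp at ha
  have hpos : 0 < S₀⁻¹.euclideanForm a a := by
    simpa [Matrix.euclideanForm_apply] using hS.inv.dotProduct_mulVec_pos ha0
  exact Real.sqrt_pos.2 (hpos.trans_le (le_ciInf fun b => hmin b.2))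

theorem sMin_sq_mul_le (hS : S₀.PosDef) (a : EuclideanSpace ℝ (Fin d)) :
    sMin S₀ ^ 2 * ‖a‖ ^ 2 ≤ S₀⁻¹.euclideanForm a a := by
  by_cases ha : a = 0
  · simp [ha]
  have hn : 0 < ‖a‖ := norm_pos_iff.2 ha
  have h0 : 0 ≤ ⨅ a : Metric.sphere (0 : EuclideanSpace ℝ (Fin d)) 1,
      (a : EuclideanSpace ℝ (Fin d)).ofLp ⬝ᵥ S₀⁻¹ *ᵥ (a : EuclideanSpace ℝ (Fin d)).ofLp :=
    Real.iInf_nonneg fun a => by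
      simpa using hS.inv.posSemidef.dotProduct_mulVec_nonneg (a : EuclideanSpace ℝ (Fin d)).ofLp
  have h1 : sMin S₀ ^ 2 ≤ S₀⁻¹.euclideanForm ((‖a‖)⁻¹ • a) ((‖a‖)⁻¹ • a) := by
    rw [sMin, Real.sq_sqrt h0]
    exact ciInf_le (bddBelow_range_form hS) ⟨(‖a‖)⁻¹ • a, by simp [norm_smul, hn.ne']⟩
  have e : ‖a‖ ^ 2 * S₀⁻¹.euclideanForm ((‖a‖)⁻¹ • a) ((‖a‖)⁻¹ • a) =
      S₀⁻¹.euclideanForm a a := by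
    simp only [map_smul, LinearMap.smul_apply, smul_eq_mul]
    field_simp
  rw [← e, mul_comm]
  gcongr

theorem form_le_sMax_sq_mul (hS : S₀.PosDef) (a : EuclideanSpace ℝ (Fin d)) :
    S₀⁻¹.euclideanForm a a ≤ sMax S₀ ^ 2 * ‖a‖ ^ 2 := by
  by_cases ha : a = 0
  · simp [ha]
  have hn : 0 < ‖a‖ := norm_pos_iff.2 ha
  have h0 : 0 ≤ ⨆ a : Metric.sphere (0 : EuclideanSpace ℝ (Fin d)) 1,
      (a : EuclideanSpace ℝ (Fin d)).ofLp ⬝ᵥ S₀⁻¹ *ᵥ (a : EuclideanSpace ℝ (Fin d)).ofLp :=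
    Real.iSup_nonneg fun a => by
      simpa using hS.inv.posSemidef.dotProduct_mulVec_nonneg (a : EuclideanSpace ℝ (Fin d)).ofLp
  have h1 : S₀⁻¹.euclideanForm ((‖a‖)⁻¹ • a) ((‖a‖)⁻¹ • a) ≤ sMax S₀ ^ 2 := by
    rw [sMax, Real.sq_sqrt h0]
    exact le_ciSup (bddAbove_range_form (S₀ := S₀)) ⟨(‖a‖)⁻¹ • a, by simp [norm_smul, hn.ne']⟩
  have e : ‖a‖ ^ 2 * S₀⁻¹.euclideanForm ((‖a‖)⁻¹ • a) ((‖a‖)⁻¹ • a) =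
      S₀⁻¹.euclideanForm a a := by
    simp only [map_smul, LinearMap.smul_apply, smul_eq_mul]
    field_simp
  rw [← e, mul_comm]
  gcongr

theorem sMin_le_sMax (hd : 1 ≤ d) (hS : S₀.PosDef) : sMin S₀ ≤ sMax S₀ := by
  have : Nonempty (Fin d) := ⟨⟨0, hd⟩⟩
  obtain ⟨a, ha⟩ : (Metric.sphere (0 : EuclideanSpace ℝ (Fin d)) 1).Nonempty :=
    NormedSpace.sphere_nonempty.2 zero_le_one
  have ha1 : ‖a‖ = 1 := by simpa using ha
  have h := (sMin_sq_mul_le hS a).trans (form_le_sMax_sq_mul hS a)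
  rw [ha1] at h
  exact (sq_le_sq₀ (Real.sqrt_nonneg _) (Real.sqrt_nonneg _)).1 (by
    rwa [one_pow, mul_one, mul_one] at h)

end Extremes

/-- The failure probabilities over a net add up to at most `δ`. -/
theorem net_union_bound_le {d M T : ℕ} (hd : 1 ≤ d) {s s' δ : ℝ} (hs : 0 < s) (hss : s ≤ s')
    (hδ : 0 < δ) (hδ1 : δ < 1) (hM : indexDimBound d T s s' δ ≤ M) :
    (1 + 48 / s * √(s' ^ 2 + T)) ^ d *
      (Real.exp (-(M / 160)) * √(3 * (1 + T / s ^ 2))) ≤ δ := by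
  set X := 1 + 48 / s * √(s' ^ 2 + T) with hX
  set τ := 1 + T / s ^ 2 with hτ
  have hX3 : 3 ≤ X := by
    have h1 : s ≤ √(s' ^ 2 + T) := by
      apply Real.le_sqrt_of_sq_le
      have : (0 : ℝ) ≤ T := by positivity
      nlinarith
    have h2 : 48 / s * s ≤ 48 / s * √(s' ^ 2 + T) := by gcongr
    rw [div_mul_cancel₀ _ hs.ne'] at h2
    linarith
  have hX0 : 0 < X := by linarith
  have hτ1 : 1 ≤ τ := by
    have : 0 ≤ (T : ℝ) / s ^ 2 := by positivity
    linarith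
  have hτ0 : 0 < τ := by linarith
  -- Since 320 = 2 · 160, a square is gained: one factor (δ/X)^d pays for the net, and the rest pays
  -- for √(3τ) ≤ Xτ and leaves δ.
  have hexp : Real.exp (-(M / 160)) ≤ ((δ / X) ^ d * τ⁻¹) ^ 2 := by
    have h1 : ((δ / X) ^ d * τ⁻¹) ^ 2 =
        Real.exp (-(2 * (d * Real.log (X / δ) + Real.log τ))) := by
      rw [show -(2 * (d * Real.log (X / δ) + Real.log τ)) =
        (2 : ℕ) * ((d : ℕ) * Real.log (δ / X) + Real.log τ⁻¹) by
          rw [Real.log_inv, ← inv_div X δ, Real.log_inv]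
          push_cast
          ring, Real.exp_nat_mul, Real.exp_add, Real.exp_nat_mul, Real.exp_log (by positivity),
          Real.exp_log (by positivity)]
    rw [h1, Real.exp_le_exp]
    rw [indexDimBound] at hM
    linarith
  have hsq : √(3 * τ) ≤ X * τ := by
    rw [Real.sqrt_le_left (by positivity)]
    calc 3 * τ ≤ 3 ^ 2 * τ ^ 2 := by nlinarith
      _ ≤ X ^ 2 * τ ^ 2 := by gcongr
      _ = (X * τ) ^ 2 := by ring
  calc X ^ d * (Real.exp (-(M / 160)) * √(3 * τ))
      ≤ X ^ d * (((δ / X) ^ d * τ⁻¹) ^ 2 * (X * τ)) := by gcongr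
    _ = (δ ^ d * τ⁻¹) * (δ ^ d * (X / X ^ d)) := by
        rw [div_pow]
        field_simp
    _ ≤ (δ * 1) * (1 * 1) := by
        have h1 : δ ^ d ≤ δ := by simpa using pow_le_pow_of_le_one hδ.le hδ1.le hd
        have h2 : X / X ^ d ≤ 1 := by
          rw [div_le_one (by positivity)]
          simpa using pow_le_pow_right₀ (by linarith : (1 : ℝ) ≤ X) hd
        have h3 : τ⁻¹ ≤ 1 := inv_le_one_of_one_le₀ hτ1
        gcongr
        exact h1.trans hδ1.le
    _ = δ := by ring

namespace BanditRun

variable {Ω 𝒜 : Type*} {d M : ℕ} (R : BanditRun Ω 𝒜 d M) {S₀ : Matrix (Fin d) (Fin d) ℝ}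

/-! ### The projected process in a fixed direction -/

/-- The perturbations in the order in which they are sampled, starting with the initial rows. -/
def allPert (n : ℕ) (ω : Ω) : EuclideanSpace ℝ (Fin M) :=
  if h : n < d then R.initPert ⟨n, h⟩ ω else R.pert (n - d + 1) ω

variable (S₀) in
/-- The coefficients of the perturbations in the direction `a`. -/
noncomputable def dirCoeff (a : Fin d → ℝ) (n : ℕ) (ω : Ω) : ℝ :=
  if h : n < d then (a ᵥ* (S₀⁻¹ * CFC.sqrt S₀)) ⟨n, h⟩ else a ⬝ᵥ R.feature (n - d + 1) ω

variable {R} in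
theorem allPert_of_lt {n : ℕ} (h : n < d) : R.allPert n = R.initPert ⟨n, h⟩ :=
  funext fun _ => dif_pos h

variable {R} in
theorem allPert_of_not_lt {n : ℕ} (h : ¬ n < d) : R.allPert n = R.pert (n - d + 1) :=
  funext fun _ => dif_neg h

/-- The information available before the `n`-th perturbation is sampled. -/
@[reducible] def pastAlgebra [MeasurableSpace 𝒜] (n : ℕ) : MeasurableSpace Ω :=
  if n < d then ⨆ i ∈ {i : Fin d | i.val < n}, MeasurableSpace.comap (R.initPert i) inferInstance
  else R.history (n - d + 1) ⊔ MeasurableSpace.comap (R.action (n - d + 1)) inferInstance ⊔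
    R.pertHistory (n - d + 1)

theorem precision_mul_factor_succ (hS : S₀.PosDef) (t : ℕ) (ω : Ω) :
    R.precision S₀ (t + 1) ω * R.factor S₀ (t + 1) ω =
      R.precision S₀ t ω * R.factor S₀ t ω +
        Matrix.vecMulVec (R.feature (t + 1) ω) (R.pertVec (t + 1) ω) := by
  rw [show R.factor S₀ (t + 1) ω = (R.precision S₀ (t + 1) ω)⁻¹ *
      (R.precision S₀ t ω * R.factor S₀ t ω +
        Matrix.vecMulVec (R.feature (t + 1) ω) (R.pertVec (t + 1) ω)) from rfl,
    Matrix.mul_nonsing_inv_cancel_left _ _ (R.isUnit_det_precision hS (t + 1) ω)]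

/-- The d initial rows come first, so time t corresponds to d + t summands. -/
theorem ofLp_adaptiveSum (hS : S₀.PosDef) (a : Fin d → ℝ) (t : ℕ) (ω : Ω) :
    (adaptiveSum (R.dirCoeff S₀ a) R.allPert (d + t) ω).ofLp =
      a ᵥ* (R.precision S₀ t ω * R.factor S₀ t ω) := by
  induction t with
  | zero =>
    rw [show R.precision S₀ 0 ω * R.factor S₀ 0 ω = S₀⁻¹ * (CFC.sqrt S₀ * R.initMatrix ω) from rfl,
      ← Matrix.mul_assoc, ← Matrix.vecMul_vecMul, add_zero, adaptiveSum, Finset.sum_range]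
    ext j
    simp [dirCoeff, allPert, Matrix.vecMul, dotProduct, initMatrix]
  | succ t ih =>
    rw [R.precision_mul_factor_succ hS, Matrix.vecMul_add, ← ih, ← add_assoc, adaptiveSum,
      Finset.sum_range_succ, WithLp.ofLp_add]
    congr 1
    have h1 : ¬ (d + t < d) := by omega
    simp [dirCoeff, allPert, Matrix.vecMul_vecMulVec, pertVec]

theorem adaptiveVar_dirCoeff (hS : S₀.PosDef) (a : Fin d → ℝ) (t : ℕ) (ω : Ω) :
    adaptiveVar (R.dirCoeff S₀ a) (d + t) ω = a ⬝ᵥ R.precision S₀ t ω *ᵥ a := by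
  induction t with
  | zero =>
    rw [show R.precision S₀ 0 ω = S₀⁻¹ from rfl]
    conv_rhs => rw [← hS.inv_mul_sqrt_mul_transpose]
    rw [← Matrix.mulVec_mulVec, Matrix.dotProduct_mulVec, Matrix.mulVec_transpose, add_zero,
      adaptiveVar, Finset.sum_range]
    simp [dirCoeff, dotProduct, sq]
  | succ t ih =>
    rw [precision, Matrix.add_mulVec, dotProduct_add, ← ih, ← add_assoc, adaptiveVar,
      Finset.sum_range_succ]
    congr 1
    simp [dirCoeff, Matrix.vecMulVec_mulVec, dotProduct_smul, sq, dotProduct_comm]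

theorem norm_adaptiveSum_sq (hS : S₀.PosDef) (a : Fin d → ℝ) (t : ℕ) (ω : Ω) :
    ‖adaptiveSum (R.dirCoeff S₀ a) R.allPert (d + t) ω‖ ^ 2 =
      a ⬝ᵥ (R.precision S₀ t ω * R.factor S₀ t ω *
        (R.precision S₀ t ω * R.factor S₀ t ω)ᵀ) *ᵥ a := by
  rw [← Matrix.mulVec_mulVec, Matrix.dotProduct_mulVec, Matrix.mulVec_transpose,
    ← R.ofLp_adaptiveSum hS, EuclideanSpace.real_norm_sq_eq]
  simp [dotProduct, sq]

variable {R}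

theorem le_form_precision (a : EuclideanSpace ℝ (Fin d)) (t : ℕ) (ω : Ω) :
    S₀⁻¹.euclideanForm a a ≤ (R.precision S₀ t ω).euclideanForm a a := by
  simp only [Matrix.euclideanForm_apply]
  induction t with
  | zero => simp [precision]
  | succ t ih =>
    have e : a.ofLp ⬝ᵥ Matrix.vecMulVec (R.feature (t + 1) ω) (R.feature (t + 1) ω) *ᵥ a.ofLp =
        (a.ofLp ⬝ᵥ R.feature (t + 1) ω) ^ 2 := by
      simp [Matrix.vecMulVec_mulVec, dotProduct_smul, sq, dotProduct_comm]
    rw [precision, Matrix.add_mulVec, dotProduct_add, e]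
    nlinarith [sq_nonneg (a.ofLp ⬝ᵥ R.feature (t + 1) ω)]

variable [MeasurableSpace Ω] [MeasurableSpace 𝒜]

theorem dotProduct_feature_sq_le {μ : Measure Ω} {Pz : Measure (EuclideanSpace ℝ (Fin M))}
    (hR : R.IsValid μ Pz) (a : EuclideanSpace ℝ (Fin d)) (t : ℕ) (ω : Ω) :
    (a.ofLp ⬝ᵥ R.feature t ω) ^ 2 ≤ ‖a‖ ^ 2 := by
  have h1 := abs_real_inner_le_norm (R.φ (R.action t ω)) a
  have h2 : inner ℝ (R.φ (R.action t ω)) a = a.ofLp ⬝ᵥ R.feature t ω := by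
    simp [EuclideanSpace.inner_eq_star_dotProduct, feature]
  rw [h2] at h1
  rw [← sq_abs]
  have h3 := hR.norm_φ_le (R.action t ω)
  gcongr
  exact h1.trans (mul_le_of_le_one_left (norm_nonneg _) h3)

theorem form_precision_le {μ : Measure Ω} {Pz : Measure (EuclideanSpace ℝ (Fin M))}
    (hR : R.IsValid μ Pz) (a : EuclideanSpace ℝ (Fin d)) (t : ℕ) (ω : Ω) :
    (R.precision S₀ t ω).euclideanForm a a ≤ S₀⁻¹.euclideanForm a a + t * ‖a‖ ^ 2 := by
  simp only [Matrix.euclideanForm_apply]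
  induction t with
  | zero => simp [precision]
  | succ t ih =>
    have h := dotProduct_feature_sq_le hR a (t + 1) ω
    have e : a.ofLp ⬝ᵥ Matrix.vecMulVec (R.feature (t + 1) ω) (R.feature (t + 1) ω) *ᵥ a.ofLp =
        (a.ofLp ⬝ᵥ R.feature (t + 1) ω) ^ 2 := by
      simp [Matrix.vecMulVec_mulVec, dotProduct_smul, sq, dotProduct_comm]
    rw [precision, Matrix.add_mulVec, dotProduct_add, e]
    push_cast
    linarith

end BanditRun

namespace BanditRun

/-! ### Measurability and independence of the perturbations -/

section Measurability

variable {Ω 𝒜 : Type*} {d M : ℕ} {R : BanditRun Ω 𝒜 d M} {S₀ : Matrix (Fin d) (Fin d) ℝ}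
  {mΩ : MeasurableSpace Ω} [MeasurableSpace 𝒜] {μ : Measure Ω}
  {Pz : Measure (EuclideanSpace ℝ (Fin M))}

theorem measurable_allPert (hR : R.IsValid μ Pz) (n : ℕ) : Measurable (R.allPert n) := by
  by_cases h : n < d
  · exact allPert_of_lt (R := R) h ▸ hR.measurable_initPert _
  · exact allPert_of_not_lt (R := R) h ▸ hR.measurable_pert _ (by omega)

theorem map_allPert (hR : R.IsValid μ Pz) (n : ℕ) : μ.map (R.allPert n) = Pz := by
  by_cases h : n < d
  · exact allPert_of_lt (R := R) h ▸ hR.law_initPert _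
  · exact allPert_of_not_lt (R := R) h ▸ hR.law_pert _ (by omega)

theorem pastAlgebra_le (hR : R.IsValid μ Pz) (n : ℕ) : R.pastAlgebra n ≤ mΩ := by
  unfold pastAlgebra
  split_ifs with h
  · exact iSup₂_le fun i _ => (hR.measurable_initPert i).comap_le
  · refine sup_le (sup_le (sup_le ?_ ?_) (hR.measurable_action _ (by omega)).comap_le)
      (sup_le ?_ ?_)
    · exact iSup₂_le fun s hs =>
        (hR.measurable_decisionSet s (Finset.mem_Icc.1 hs).1).comap_le
    · exact iSup₂_le fun s hs => sup_le
        (hR.measurable_action s (Finset.mem_Ico.1 hs).1).comap_le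
        (hR.measurable_feedback s (Finset.mem_Ico.1 hs).1).comap_le
    · exact iSup_le fun i => (hR.measurable_initPert i).comap_le
    · exact iSup₂_le fun s hs => (hR.measurable_pert s (Finset.mem_Ico.1 hs).1).comap_le

theorem measurable_allPert_pastAlgebra {n k : ℕ} (hk : k < n) :
    Measurable[R.pastAlgebra n] (R.allPert k) := by
  apply Measurable.of_comap_le
  by_cases hn : n < d
  · have hkd : k < d := by omega
    rw [pastAlgebra, if_pos hn]
    rw [allPert_of_lt hkd]
    exact le_iSup₂_of_le (⟨k, hkd⟩ : Fin d) hk le_rfl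
  · rw [pastAlgebra, if_neg hn]
    refine le_trans ?_ le_sup_right
    by_cases hkd : k < d
    · rw [allPert_of_lt hkd]
      exact le_sup_of_le_left (le_iSup_of_le (⟨k, hkd⟩ : Fin d) le_rfl)
    · rw [allPert_of_not_lt hkd]
      exact le_sup_of_le_right
        (le_iSup₂_of_le (k - d + 1) (Finset.mem_Ico.2 ⟨by omega, by omega⟩) le_rfl)

/-- Predictability includes k = n: beyond the initial rows, `pastAlgebra` contains the current
action, which is chosen before its perturbation is drawn. -/
theorem measurable_dirCoeff (hR : R.IsValid μ Pz) (a : Fin d → ℝ) {n k : ℕ} (hk : k ≤ n) :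
    Measurable[R.pastAlgebra n] (R.dirCoeff S₀ a k) := by
  by_cases hkd : k < d
  · rw [show R.dirCoeff S₀ a k = fun _ => (a ᵥ* (S₀⁻¹ * CFC.sqrt S₀)) ⟨k, hkd⟩ from
      funext fun _ => dif_pos hkd]
    exact measurable_const
  · rw [show R.dirCoeff S₀ a k = fun ω => a ⬝ᵥ R.feature (k - d + 1) ω from
      funext fun _ => dif_neg hkd]
    have hφ : Measurable fun x => a ⬝ᵥ (R.φ x).ofLp := by
      have := hR.measurable_φ
      simp only [dotProduct]
      fun_prop
    refine hφ.comp (Measurable.of_comap_le ?_)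
    rw [pastAlgebra, if_neg (by omega : ¬ n < d)]
    refine le_sup_of_le_left ?_
    rcases Nat.lt_or_eq_of_le hk with h | rfl
    · exact le_sup_of_le_left (le_sup_of_le_right
        (le_iSup₂_of_le (k - d + 1) (Finset.mem_Ico.2 ⟨by omega, by omega⟩) le_sup_left))
    · exact le_sup_right

theorem indep_allPert (hR : R.IsValid μ Pz) (n : ℕ) :
    Indep (MeasurableSpace.comap (R.allPert n) inferInstance) (R.pastAlgebra n) μ := by
  by_cases hn : n < d
  · have h := indep_iSup_of_disjoint (fun i => (hR.measurable_initPert i).comap_le)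
      hR.indep_initPert (S := {⟨n, hn⟩}) (T := {i : Fin d | i.val < n}) (by simp)
    rw [pastAlgebra, if_pos hn]
    rw [allPert_of_lt hn]
    simpa using h
  · rw [pastAlgebra, if_neg hn]
    rw [allPert_of_not_lt hn]
    exact hR.indep_pert _ (by omega)

end Measurability

/-! ### Uncertainty estimation -/

section Estimation

variable {Ω 𝒜 : Type*} {d M : ℕ} (R : BanditRun Ω 𝒜 d M) {S₀ : Matrix (Fin d) (Fin d) ℝ}

/-- The event that the squared norm of the projected process in direction `a` stays close to its
predictable variance up to time `T`. -/
def dirGood (S₀ : Matrix (Fin d) (Fin d) ℝ) (T : ℕ) (a : EuclideanSpace ℝ (Fin d)) : Set Ω :=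
  adaptiveGood (R.dirCoeff S₀ a.ofLp) R.allPert (S₀⁻¹.euclideanForm a a / 2) (1 / 4) (d + T)

variable {R}

theorem measure_compl_dirGood_le [MeasurableSpace Ω] [MeasurableSpace 𝒜] {μ : Measure Ω}
    [IsProbabilityMeasure μ] {Pz : Measure (EuclideanSpace ℝ (Fin M))} [IsProbabilityMeasure Pz]
    (hsub : IsSubGaussianLaw Pz (NNReal.sqrt (1 / M))) (hunit : IsUnitNormLaw Pz)
    (hR : R.IsValid μ Pz) (hd : 1 ≤ d) (hS : S₀.PosDef) (T : ℕ) {a : EuclideanSpace ℝ (Fin d)}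
    (ha : ‖a‖ = 1) :
    μ (R.dirGood S₀ T a)ᶜ ≤
      ENNReal.ofReal (Real.exp (-(M / 160)) * √(3 * (1 + T / sMin S₀ ^ 2))) := by
  have hs := sMin_pos hd hS
  set v := S₀⁻¹.euclideanForm a a with hv
  have hsv : sMin S₀ ^ 2 ≤ v := by simpa [ha] using sMin_sq_mul_le hS a
  have hv0 : 0 < v := (by positivity : 0 < sMin S₀ ^ 2).trans_le hsv
  -- With ε = 1/4 and σ² = 1/M, θ = M/10 is the largest value allowed by 8θ(1 + ε)σ² ≤ 1 when M > 0,
  -- and θε² = M/160. Unit features give V ≤ v + T.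
  have h := measure_compl_adaptiveGood_le (μ := μ) hsub hunit (N := d + T) (z := R.allPert)
    (c := R.dirCoeff S₀ a.ofLp) (F := R.pastAlgebra) (fun n _ => pastAlgebra_le hR n)
    (fun n _ => measurable_allPert hR n) (fun n _ k hk => measurable_allPert_pastAlgebra hk)
    (fun n _ k hk => measurable_dirCoeff hR a.ofLp hk) (fun n _ => map_allPert hR n)
    (fun n _ => indep_allPert hR n) (w := v / 2) (ε := 1 / 4) (θ := M / 10) (B := v + T)
    (by positivity) (by norm_num) (by positivity) (by
      rw [← NNReal.coe_pow, NNReal.sq_sqrt]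
      push_cast
      rcases eq_or_ne (M : ℝ) 0 with h0 | h0
      · simp [h0]
      · field_simp
        norm_num) (fun ω => by
      rw [R.adaptiveVar_dirCoeff hS, ← Matrix.euclideanForm_apply]
      simpa [ha] using form_precision_le (S₀ := S₀) hR a T ω)
  refine h.trans (ENNReal.ofReal_le_ofReal ?_)
  have e1 : -((M : ℝ) / 10 * (1 / 4) ^ 2) = -(M / 160) := by ring
  have e2 : (v / 2 + (v + T)) / (v / 2) ≤ 3 * (1 + T / sMin S₀ ^ 2) := by
    rw [show (v / 2 + (v + T)) / (v / 2) = 3 + 2 * (T / v) by field_simp; ring]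
    have h1 : (T : ℝ) / v ≤ T / sMin S₀ ^ 2 := by gcongr
    have h2 : 0 ≤ (T : ℝ) / sMin S₀ ^ 2 := by positivity
    linarith
  rw [e1]
  gcongr

/-- Evaluate at a = Σ_t x: both outer factors P_t cancel against Σ_t, which turns the two forms into
xᵀ A_t A_tᵀ x and xᵀ Σ_t x. -/
theorem mem_goodEvent_of_form_le (hS : S₀.PosDef) {t : ℕ} {ω : Ω}
    (h : ∀ a : EuclideanSpace ℝ (Fin d),
      |(R.precision S₀ t ω * R.factor S₀ t ω * (R.precision S₀ t ω * R.factor S₀ t ω)ᵀ -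
        R.precision S₀ t ω).euclideanForm a a| ≤
          1 / 2 * (R.precision S₀ t ω).euclideanForm a a) : ω ∈ R.goodEvent S₀ t := by
  intro x
  set P := R.precision S₀ t ω with hP
  set A := R.factor S₀ t ω
  have hu : IsUnit P.det := R.isUnit_det_precision hS t ω
  have hPT : Pᵀ = P := by
    simpa [Matrix.conjTranspose_eq_transpose_of_trivial] using
      (R.posDef_precision hS t ω).isHermitian.eq
  have hcov : R.covariance S₀ t ω = P⁻¹ := rfl
  have h1 := h (WithLp.toLp 2 (P⁻¹ *ᵥ x))
  rw [Matrix.euclideanForm_apply, Matrix.euclideanForm_apply, Matrix.sub_mulVec,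
    dotProduct_sub] at h1
  have e1 : (P⁻¹ *ᵥ x) ⬝ᵥ P *ᵥ (P⁻¹ *ᵥ x) = x ⬝ᵥ P⁻¹ *ᵥ x := by
    rw [Matrix.mulVec_mulVec, Matrix.mul_nonsing_inv _ hu, Matrix.one_mulVec, dotProduct_comm]
  have e2 : (P⁻¹ *ᵥ x) ⬝ᵥ (P * A * (P * A)ᵀ) *ᵥ (P⁻¹ *ᵥ x) = x ⬝ᵥ (A * Aᵀ) *ᵥ x := by
    have hx : P⁻¹ *ᵥ x = x ᵥ* P⁻¹ := by
      conv_lhs => rw [← hPT, ← Matrix.transpose_nonsing_inv, Matrix.mulVec_transpose]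
    rw [Matrix.mulVec_mulVec]
    nth_rewrite 1 [hx]
    rw [← Matrix.dotProduct_mulVec, Matrix.mulVec_mulVec, Matrix.transpose_mul, hPT,
      show P⁻¹ * (P * A * (Aᵀ * P) * P⁻¹) = (P⁻¹ * P) * A * Aᵀ * (P * P⁻¹) by
        simp only [Matrix.mul_assoc], Matrix.nonsing_inv_mul _ hu, Matrix.mul_nonsing_inv _ hu,
      Matrix.one_mul, Matrix.mul_one]
  simp only [e1, e2] at h1
  rw [hcov]
  have := abs_le.1 h1
  constructor <;> linarith

theorem mem_goodEvent_of_net [MeasurableSpace Ω] [MeasurableSpace 𝒜] {μ : Measure Ω}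
    {Pz : Measure (EuclideanSpace ℝ (Fin M))} (hR : R.IsValid μ Pz) (hd : 1 ≤ d)
    (hS : S₀.PosDef) {T : ℕ} {r : ℝ}
    (hr : (sMax S₀ ^ 2 + T) * r ^ 2 ≤ sMin S₀ ^ 2 / 576)
    {s : Finset (EuclideanSpace ℝ (Fin d))}
    (hnet : ∀ a : EuclideanSpace ℝ (Fin d), ‖a‖ = 1 → ∃ b ∈ s, ‖a - b‖ ≤ r) {ω : Ω}
    (hω : ∀ b ∈ s, ω ∈ R.dirGood S₀ T b) {t : ℕ} (ht : t ≤ T) : ω ∈ R.goodEvent S₀ t := by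
  have hs := sMin_pos hd hS
  have hPT : (R.precision S₀ t ω)ᵀ = R.precision S₀ t ω := by
    simpa [Matrix.conjTranspose_eq_transpose_of_trivial] using
      (R.posDef_precision hS t ω).isHermitian.eq
  refine mem_goodEvent_of_form_le hS fun a => ?_
  refine abs_form_le_of_net (Matrix.euclideanForm_comm ?_) (Matrix.euclideanForm_comm hPT)
    (Matrix.continuous_euclideanForm_self _) (Matrix.continuous_euclideanForm_self _)
    (α := sMin S₀ ^ 2) (β := sMax S₀ ^ 2 + T) (by positivity)
    (fun x => (sMin_sq_mul_le hS x).trans (le_form_precision x t ω)) (fun x => ?_) hr hnet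
    (fun b hb => ?_) a
  · rw [Matrix.transpose_sub, Matrix.transpose_mul, Matrix.transpose_transpose, hPT]
  · have h1 := form_precision_le (S₀ := S₀) hR x t ω
    have h2 := form_le_sMax_sq_mul hS x
    have h3 : (t : ℝ) * ‖x‖ ^ 2 ≤ T * ‖x‖ ^ 2 := by gcongr
    linarith
  · have h1 := hω b hb (d + t) (by omega)
    rw [R.norm_adaptiveSum_sq hS, R.adaptiveVar_dirCoeff hS] at h1
    -- The initial form v is at most V, so the error (v/2 + V)/4 is at most 3V/8, as the net lemma
    -- requires.
    have h2 := le_form_precision (R := R) (S₀ := S₀) b t ω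
    rw [Matrix.euclideanForm_apply, Matrix.sub_mulVec, dotProduct_sub]
    rw [Matrix.euclideanForm_apply (R.precision S₀ t ω)] at h2 ⊢
    refine h1.trans ?_
    linarith

theorem le_measure_goodEvent [MeasurableSpace Ω] [MeasurableSpace 𝒜] {μ : Measure Ω}
    [IsProbabilityMeasure μ] {Pz : Measure (EuclideanSpace ℝ (Fin M))} [IsProbabilityMeasure Pz]
    (hsub : IsSubGaussianLaw Pz (NNReal.sqrt (1 / M))) (hunit : IsUnitNormLaw Pz)
    (hR : R.IsValid μ Pz) (hd : 1 ≤ d) (hS : S₀.PosDef) {T : ℕ} {δ : ℝ} (hδ : 0 < δ)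
    (hδ1 : δ < 1) (hM : indexDimBound d T (sMin S₀) (sMax S₀) δ ≤ M) :
    ENNReal.ofReal (1 - δ) ≤ μ (⋂ t ∈ Finset.range (T + 1), R.goodEvent S₀ t) := by
  have hs := sMin_pos hd hS
  have hss := sMin_le_sMax hd hS
  have hs' : 0 < sMax S₀ := hs.trans_le hss
  set β := √(sMax S₀ ^ 2 + T) with hβ
  have hβ0 : 0 < β := by positivity
  -- This radius gives β²r² = s_min²/576, and 2/r = 48β/s_min is the term in the threshold.
  set r := sMin S₀ / (24 * β) with hr
  have hr0 : 0 < r := by positivity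
  obtain ⟨s, hs1, hnet, hcard⟩ := exists_finset_net_sphere (EuclideanSpace ℝ (Fin d)) hr0
  have hr2 : (sMax S₀ ^ 2 + T) * r ^ 2 ≤ sMin S₀ ^ 2 / 576 := by
    rw [← Real.sq_sqrt (by positivity : 0 ≤ sMax S₀ ^ 2 + (T : ℝ)), ← hβ, hr]
    apply le_of_eq
    field_simp
    norm_num
  have hcard' : (s.card : ℝ) ≤ (1 + 48 / sMin S₀ * β) ^ d := by
    rw [finrank_euclideanSpace_fin] at hcard
    have e : 2 / r = 48 / sMin S₀ * β := by
      rw [hr]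
      field_simp
      norm_num
    rwa [e] at hcard
  have hsubset : (⋃ b ∈ s, (R.dirGood S₀ T b)ᶜ)ᶜ ⊆
      ⋂ t ∈ Finset.range (T + 1), R.goodEvent S₀ t := by
    intro ω hω
    simp only [Set.compl_iUnion, compl_compl, Set.mem_iInter] at hω ⊢
    intro t ht
    exact mem_goodEvent_of_net hR hd hS hr2 hnet hω (Nat.lt_succ_iff.1 (Finset.mem_range.1 ht))
  have hbad : μ (⋃ b ∈ s, (R.dirGood S₀ T b)ᶜ) ≤ ENNReal.ofReal δ := by
    calc _ ≤ ∑ b ∈ s, μ (R.dirGood S₀ T b)ᶜ := measure_biUnion_finset_le _ _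
      _ ≤ ∑ b ∈ s, ENNReal.ofReal (Real.exp (-(M / 160)) *
          √(3 * (1 + T / sMin S₀ ^ 2))) := Finset.sum_le_sum fun b hb =>
          measure_compl_dirGood_le hsub hunit hR hd hS T (hs1 b hb)
      _ = ENNReal.ofReal (s.card * (Real.exp (-(M / 160)) *
          √(3 * (1 + T / sMin S₀ ^ 2)))) := by
          rw [Finset.sum_const, nsmul_eq_mul, ENNReal.ofReal_mul (Nat.cast_nonneg _),
            ENNReal.ofReal_natCast]
      _ ≤ ENNReal.ofReal δ := ENNReal.ofReal_le_ofReal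
          ((mul_le_mul_of_nonneg_right hcard' (by positivity)).trans
            (net_union_bound_le hd hs hss hδ hδ1 hM))
  calc ENNReal.ofReal (1 - δ) = 1 - ENNReal.ofReal δ := by
        rw [ENNReal.ofReal_sub _ hδ.le, ENNReal.ofReal_one]
    _ ≤ 1 - μ (⋃ b ∈ s, (R.dirGood S₀ T b)ᶜ) := tsub_le_tsub_left hbad _
    -- Subadditivity suffices here, so no measurability of the events is needed.
    _ ≤ μ (⋃ b ∈ s, (R.dirGood S₀ T b)ᶜ)ᶜ := by
        rw [tsub_le_iff_right, ← measure_univ (μ := μ), ← Set.compl_union_self]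
        exact measure_union_le _ _
    _ ≤ _ := measure_mono hsubset

end Estimation

end BanditRun

theorem mainTheorem3 :
    -- uncertainty estimation, and the update procedure computes the factor
    (∀ {Ω 𝒜 : Type*} [MeasurableSpace Ω] [MeasurableSpace 𝒜]
      (μ : Measure Ω) [IsProbabilityMeasure μ]
      (d M T : ℕ) (_ : 1 ≤ d)
      (Pz : Measure (EuclideanSpace ℝ (Fin M))) [IsProbabilityMeasure Pz]
      (_ : IsSubGaussianLaw Pz (NNReal.sqrt (1 / M))) (_ : IsUnitNormLaw Pz)
      (R : BanditRun Ω 𝒜 d M) (_ : R.IsValid μ Pz)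
      (S₀ : Matrix (Fin d) (Fin d) ℝ) (_ : S₀.PosDef)
      (δ : ℝ) (_ : 0 < δ) (_ : δ < 1)
      (_ : (M : ℝ) ≥ indexDimBound d T (sMin S₀) (sMax S₀) δ),
      ENNReal.ofReal (1 - δ) ≤ μ (⋂ t ∈ Finset.range (T + 1), R.goodEvent S₀ t) ∧
      ∀ (t : ℕ) (ω : Ω),
        (incrementalUpdate (R.updateState S₀ t ω) (R.feature (t + 1) ω)
          (R.pertVec (t + 1) ω)).val = R.updateState S₀ (t + 1) ω) ∧
    -- the threshold is of order `d log T`, and at the least admissible index dimension one update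
    -- takes `O(d ^ 3 log T)` arithmetic operations
    (∀ (s s' δ : ℝ), 0 < s → s ≤ s' → 0 < δ → δ < 1 →
      ∃ c C K : ℝ, 0 < c ∧ 0 < C ∧ 0 < K ∧ ∀ d T : ℕ, 1 ≤ d → 2 ≤ T →
        c * (d * Real.log T) ≤ indexDimBound d T s s' δ ∧
        indexDimBound d T s s' δ ≤ C * (d * Real.log T) ∧
        ∀ (st : UpdateState d ⌈indexDimBound d T s s' δ⌉₊) (x : Fin d → ℝ)
          (z : Fin ⌈indexDimBound d T s s' δ⌉₊ → ℝ),
          ((incrementalUpdate st x z).ops : ℝ) ≤ K * (d ^ 3 * Real.log T)) := by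
  refine ⟨?_, fun s s' δ hs _ hδ hδ1 => exists_threshold_order_and_ops_le hs hδ hδ1⟩
  intro Ω 𝒜 _ _ μ _ d M T hd Pz _ hsub hunit R hR S₀ hS δ hδ hδ1 hM
  exact ⟨BanditRun.le_measure_goodEvent hsub hunit hR hd hS hδ hδ1 hM,
    fun t ω => R.incrementalUpdate_val hS t ω⟩
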